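/- Let $J$ be a real symmetric positive definite matrix with unit diagonal, indexed by a finite set $\mathcal V$, let $h\in\mathbb R^{\mathcal V}$, and let $\mathcal G=(\mathcal V,\mathcal E)$ be the graph with an edge $\{i,j\}$ ($i\ne j$) exactly when $J_{ij}\neq 0$. The Gaussian model $p(x)\propto\exp(-\tfrac12x^{T}Jx+h^{T}x)$ has mean $\mu=J^{-1}h$ and covariance $P=J^{-1}$. Put $R=I-J$. A walk $w=(w_0,\dots,w_l)$, $l\ge 0$, moves along edges of $\mathcal G$ and has weight $\phi(w)=\prod_{k=1}^{l}R_{w_{k-1}w_k}$ (weight $1$ if $l=0$). A self-return walk of $i$ is a walk from $i$ to $i$; it is backtracking if it can be reduced to the single node $i$ by successively replacing subwalks $(a,b,a)$ by $(a)$. The model is walk-summable if for all $i,j$ the sum of the weights of all walks from $i$ to $j$ converges absolutely. Loopy belief propagation (LBP) with parameters $(J,h)$ updates messages on the directed edges, starting from initial values $\Delta J^{(0)},\Delta h^{(0)}$, by $\Delta J_{i\to j}\leftarrow -J_{ji}\hat J_{i\backslash j}^{-1}J_{ij}$ and $\Delta h_{i\to j}\leftarrow -J_{ji}\hat J_{i\backslash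 j}^{-1}\hat h_{i\backslash j}$, where $\hat J_{i\backslash j}=J_{ii}+\sum_{k\in\mathcal N(i)\setminus j}\Delta J_{k\to i}$ and $\hat h_{i\backslash j}=h_i+\sum_{k\in\mathcal N(i)\setminus j}\Delta h_{k\to i}$. Put $\hat J_i=J_{ii}+\sum_{k\in\mathcal N(i)}\Delta J_{k\to i}$ and $\hat h_i=h_i+\sum_{k\in\mathcal N(i)}\Delta h_{k\to i}$. LBP converges if all messages converge and, at the limiting messages, all $\hat J_{i\backslash j}$ and $\hat J_i$ are nonzero; it then outputs the variances $\hat J_i^{-1}$ and the means $\hat J_i^{-1}\hat h_i$ at the limiting messages. Let $\tilde F\subseteq\mathcal V$ be any set of nodes (in particular a pseudo-FVS), and let $\tilde T$ be the graph obtained by deleting $\tilde F$. Approximate feedback message passing (FMP) with $\tilde F$ does the following. (1) It runs LBP on $\tilde T$ with $J_{\tilde T}$ and potential $h_{\tilde T}$, which gives partial variances $P^{\tilde T}_{ii}$ and partial means $\mu^{\tilde T}_i$; for each $p\in\tilde F$ it runs LBP with potential $J_{\tilde T,p}$, whose means are the feedback gains $g^p_i$. (2) It forms $(\hat J_{\tilde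 F})_{pq}=J_{pq}-\sum_{j\in\mathcal N(p)\cap\tilde T}J_{pj}g^q_j$ and $(\hat h_{\tilde F})_p=h_p-\sum_{j\in\mathcal N(p)\cap\tilde T}J_{pj}\mu^{\tilde T}_j$, and outputs on $\tilde F$ the covariance $P_{\tilde F}=\hat J_{\tilde F}^{-1}$ and the means $\mu_{\tilde F}=\hat J_{\tilde F}^{-1}\hat h_{\tilde F}$. (3) It runs LBP on $\tilde T$ with potential $\tilde h_i=h_i-\sum_{j\in\mathcal N(i)\cap\tilde F}J_{ij}(\mu_{\tilde F})_j$ and outputs its means on $\tilde T$, together with the variances $\hat P_{ii}=P^{\tilde T}_{ii}+\sum_{p,q\in\tilde F}g^p_i(P_{\tilde F})_{pq}g^q_i$, $i\in\tilde T$. Suppose that approximate FMP converges, i.e. that all these LBP runs converge (from arbitrary initial messages). Then: (a) The computed means equal $\mu_i$ at all nodes $i\in\mathcal V$, and the computed variances equal $P_{ii}$ for all $i\in\tilde F$. (b) Suppose in addition that the first LBP run on $\tilde T$ starts from nonnegative messages $\Delta J^{(0)}$ (for instance zero) and that either its limiting precisions $\hat J_{i\backslash j}$ and $\hat J_i$ are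 positive, i.e. the fixed-point messages and beliefs are proper Gaussians, or the model on $\tilde T$ is walk-summable. Then for every $i\in\tilde T$ the sum $b_i$ of the weights of all backtracking walks of $i$ within $\tilde T$ converges absolutely, and $\hat P_{ii}=b_i+\bigl(P_{ii}-(J_{\tilde T}^{-1})_{ii}\bigr)$. In terms of walks, $\hat P_{ii}=b_i+s_i$ and $P_{ii}=\hat P_{ii}+m_i$, where $s_i$ is the sum over all self-return walks of $i$ that visit $\tilde F$ and $m_i$ is the sum over all non-backtracking self-return walks of $i$ within $\tilde T$, so that only the latter are missed. Each of these two identities holds whenever the walk-sum $s_i$, respectively $m_i$, ordered by walk-length, converges; both sums converge in this order if the spectral radius of $R$ is less than $1$, and both converge absolutely if the model is walk-summable. -/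

import Mathlib

open scoped Matrix Topology

noncomputable section

namespace GaussFMP

/-! ### Loopy belief propagation on a Gaussian graphical model -/

/-- A pair of message arrays: `J i j` is the message `ΔJ_{i → j}` and `h i j` is the message
`Δh_{i → j}`. Only the entries at edges of the graph are ever used. -/
structure Messages (V : Type*) where
  J : V → V → ℝ
  h : V → V → ℝ

section LBP

variable {V : Type*} [Fintype V] [DecidableEq V] (G : SimpleGraph V) [DecidableRel G.Adj]
  (J : Matrix V V ℝ) (h : V → ℝ)

/-- `Ĵ_{i \ j} = J_{ii} + ∑_{k ∈ N(i) \ j} ΔJ_{k → i}`. -/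
def cavityPrecision (m : Messages V) (i j : V) : ℝ :=
  J i i + ∑ k ∈ (G.neighborFinset i).erase j, m.J k i

/-- `ĥ_{i \ j} = h_i + ∑_{k ∈ N(i) \ j} Δh_{k → i}`. -/
def cavityPotential (m : Messages V) (i j : V) : ℝ :=
  h i + ∑ k ∈ (G.neighborFinset i).erase j, m.h k i

/-- `Ĵ_i = J_{ii} + ∑_{k ∈ N(i)} ΔJ_{k → i}`. -/
def nodePrecision (m : Messages V) (i : V) : ℝ :=
  J i i + ∑ k ∈ G.neighborFinset i, m.J k i

/-- `ĥ_i = h_i + ∑_{k ∈ N(i)} Δh_{k → i}`. -/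
def nodePotential (m : Messages V) (i : V) : ℝ :=
  h i + ∑ k ∈ G.neighborFinset i, m.h k i

/-- One (parallel) update of all messages. -/
def lbpStep (m : Messages V) : Messages V where
  J i j := -(J j i * (cavityPrecision G J m i j)⁻¹ * J i j)
  h i j := -(J j i * (cavityPrecision G J m i j)⁻¹ * cavityPotential G h m i j)

/-- The messages after `t` iterations, starting from the initial messages `m₀`. -/
def lbpIter (m₀ : Messages V) (t : ℕ) : Messages V :=
  (lbpStep G J h)^[t] m₀

/-- LBP started from `m₀` converges: the messages on all (directed) edges converge, and the limits
are such that no zero denominator occurs in the message updates or in the final variances and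
means. -/
def LBPConverges (m₀ : Messages V) : Prop :=
  ∃ m : Messages V,
    (∀ i j, G.Adj i j →
      Filter.Tendsto (fun t => (lbpIter G J h m₀ t).J i j) Filter.atTop (𝓝 (m.J i j)) ∧
      Filter.Tendsto (fun t => (lbpIter G J h m₀ t).h i j) Filter.atTop (𝓝 (m.h i j))) ∧
    (∀ i j, G.Adj i j → cavityPrecision G J m i j ≠ 0) ∧
    (∀ i, nodePrecision G J m i ≠ 0)

/-- The fixed-point (limiting) messages. -/
def lbpLimit (m₀ : Messages V) : Messages V where
  J i j := Filter.limUnder Filter.atTop (fun t => (lbpIter G J h m₀ t).J i j)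
  h i j := Filter.limUnder Filter.atTop (fun t => (lbpIter G J h m₀ t).h i j)

/-- The variance of node `i` computed by LBP. -/
def lbpVar (m₀ : Messages V) (i : V) : ℝ :=
  (nodePrecision G J (lbpLimit G J h m₀) i)⁻¹

/-- The mean of node `i` computed by LBP. -/
def lbpMean (m₀ : Messages V) (i : V) : ℝ :=
  (nodePrecision G J (lbpLimit G J h m₀) i)⁻¹ * nodePotential G h (lbpLimit G J h m₀) i

/-- The limiting precisions are positive, so that the fixed-point messages and beliefs of LBP are
genuine (normalizable) Gaussians. -/
def LBPProper (m₀ : Messages V) : Prop :=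
  (∀ i j, G.Adj i j → 0 < cavityPrecision G J (lbpLimit G J h m₀) i j) ∧
  (∀ i, 0 < nodePrecision G J (lbpLimit G J h m₀) i)

end LBP

/-! ### Approximate feedback message passing -/

section FMP

variable {V : Type*}

/-- The set of nodes that remain after the feedback nodes `F` are eliminated. -/
abbrev Rest (F : Finset V) : Type _ := {i : V // i ∉ F}

/-- The graph that remains after the feedback nodes `F` are eliminated. -/
abbrev restGraph (G : SimpleGraph V) (F : Finset V) : SimpleGraph (Rest F) :=
  G.comap Subtype.val

/-- The information matrix restricted to the remaining nodes. -/
abbrev restJ (J : Matrix V V ℝ) (F : Finset V) : Matrix (Rest F) (Rest F) ℝ :=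
  J.submatrix Subtype.val Subtype.val

/-- The potential vector restricted to the remaining nodes. -/
abbrev restPotential (h : V → ℝ) (F : Finset V) : Rest F → ℝ := fun i => h i

/-- The initial messages of the LBP runs made by approximate FMP: the run with the original
potentials, the runs with the extra potential vectors of the feedback nodes, and the second
round. -/
structure FMPInit (F : Finset V) where
  base : Messages (Rest F)
  gain : F → Messages (Rest F)
  final : Messages (Rest F)

variable [Fintype V] [DecidableEq V] (G : SimpleGraph V) [DecidableRel G.Adj]
  (J : Matrix V V ℝ) (h : V → ℝ) (F : Finset V) (ini : FMPInit F)

/-- Step 1: the extra potential vector of the feedback node `p`. -/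
def extraPotential (p : F) : Rest F → ℝ := fun i => J i p

/-- Step 2: partial variances. -/
def partialVar (i : Rest F) : ℝ :=
  lbpVar (restGraph G F) (restJ J F) (restPotential h F) ini.base i

/-- Step 2: partial means. -/
def partialMean (i : Rest F) : ℝ :=
  lbpMean (restGraph G F) (restJ J F) (restPotential h F) ini.base i

/-- Step 2: feedback gains. -/
def feedbackGain (p : F) (i : Rest F) : ℝ :=
  lbpMean (restGraph G F) (restJ J F) (extraPotential J F p) (ini.gain p) i

/-- Step 3: the information matrix of the inference problem on the feedback nodes. -/
def hatJ : Matrix F F ℝ :=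
  Matrix.of fun p q =>
    J p q - ∑ j ∈ Finset.univ.filter (fun j : Rest F => G.Adj p j), J p j * feedbackGain G J F ini q j

/-- Step 3: the potential vector of the inference problem on the feedback nodes. -/
def hatPotential (p : F) : ℝ :=
  h p - ∑ j ∈ Finset.univ.filter (fun j : Rest F => G.Adj p j), J p j * partialMean G J h F ini j

/-- Step 3: the computed covariance matrix of the feedback nodes. -/
def feedbackCov : Matrix F F ℝ := (hatJ G J F ini)⁻¹

/-- Step 3: the computed means of the feedback nodes. -/
def feedbackMean : F → ℝ := (hatJ G J F ini)⁻¹ *ᵥ hatPotential G J h F ini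

/-- Step 4: the revised potential vector on the remaining graph. -/
def revisedPotential (i : Rest F) : ℝ :=
  h i - ∑ j ∈ Finset.univ.filter (fun j : F => G.Adj i j), J i j * feedbackMean G J h F ini j

/-- The means computed by approximate FMP (Step 3 on `F`, Step 5 elsewhere). -/
def fmpMean (i : V) : ℝ :=
  if hi : i ∈ F then feedbackMean G J h F ini ⟨i, hi⟩
  else lbpMean (restGraph G F) (restJ J F) (revisedPotential G J h F ini) ini.final ⟨i, hi⟩

/-- The variances computed by approximate FMP (Step 3 on `F`, Step 5 elsewhere). -/
def fmpVar (i : V) : ℝ :=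
  if hi : i ∈ F then feedbackCov G J F ini ⟨i, hi⟩ ⟨i, hi⟩
  else partialVar G J h F ini ⟨i, hi⟩ +
    ∑ p : F, ∑ q : F, feedbackGain G J F ini p ⟨i, hi⟩ * feedbackCov G J F ini p q *
      feedbackGain G J F ini q ⟨i, hi⟩

/-- Approximate FMP converges: each of its LBP runs converges. -/
def FMPConverges : Prop :=
  LBPConverges (restGraph G F) (restJ J F) (restPotential h F) ini.base ∧
  (∀ p : F, LBPConverges (restGraph G F) (restJ J F) (extraPotential J F p) (ini.gain p)) ∧
  LBPConverges (restGraph G F) (restJ J F) (revisedPotential G J h F ini) ini.final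

end FMP

/-! ### Walk-sums -/

section Walks

variable {V : Type*} {G : SimpleGraph V}

/-- The weight of a walk: the product of the edge weights along it. -/
def walkWeight (R : Matrix V V ℝ) {i j : V} (w : G.Walk i j) : ℝ :=
  (w.darts.map fun d => R d.fst d.snd).prod

/-- Absolute (equivalently, order-independent) convergence of all walk-sums. -/
def WalkSummable (G : SimpleGraph V) (R : Matrix V V ℝ) : Prop :=
  ∀ i j : V, Summable fun w : G.Walk i j => walkWeight R w

/-- The walk-sum of the set `W` of walks from `i` to `j`, with the summation ordered by
walk-length, converges to `s`. -/
def HasWalkSum [Fintype V] [DecidableEq V] [DecidableRel G.Adj] (R : Matrix V V ℝ) {i j : V}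
    (W : Set (G.Walk i j)) (s : ℝ) : Prop :=
  Filter.Tendsto
    (fun N : ℕ => ∑ w ∈ G.finsetWalkLengthLT N i j, W.indicator (walkWeight R) w)
    Filter.atTop (𝓝 s)

/-- One reduction of a vertex sequence: a subwalk `a, b, a` is replaced by the single node `a`. -/
def BacktrackStep (l l' : List V) : Prop :=
  ∃ (l₁ l₂ : List V) (a b : V), l = l₁ ++ a :: b :: a :: l₂ ∧ l' = l₁ ++ a :: l₂

/-- A self-return walk is backtracking if it can be reduced consecutively to a single node. -/
def IsBacktracking {i : V} (w : G.Walk i i) : Prop :=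
  Relation.ReflTransGen BacktrackStep w.support [i]

/-- The self-return walks of `i` that visit `F`. -/
def visitingWalks (G : SimpleGraph V) (F : Finset V) (i : V) : Set (G.Walk i i) :=
  {w | ∃ v ∈ w.support, v ∈ F}

/-- The backtracking walks of `i` within the complement of `F`. -/
def backtrackingWalks (G : SimpleGraph V) (F : Finset V) (i : V) : Set (G.Walk i i) :=
  {w | (∀ v ∈ w.support, v ∉ F) ∧ IsBacktracking w}

/-- The non-backtracking self-return walks of `i` within the complement of `F`. -/
def nonBacktrackingWalks (G : SimpleGraph V) (F : Finset V) (i : V) : Set (G.Walk i i) :=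
  {w | (∀ v ∈ w.support, v ∉ F) ∧ ¬ IsBacktracking w}

end Walks

end GaussFMP

end

open scoped Matrix Topology

noncomputable section

namespace GaussFMP

/-! ### Fixed points of loopy belief propagation -/

section FixedPoint

variable {V : Type*} [Fintype V] [DecidableEq V] (G : SimpleGraph V) [DecidableRel G.Adj]
  (J : Matrix V V ℝ) (h : V → ℝ)

/-! Means. At a fixed point of the messages with no zero denominators, the two opposite messages on
each edge force the node means to solve `J x = h`, whether or not the graph has loops
(`IsFixedPoint.mulVec_eq`). Write `J_T` for `restJ J F`. It is positive definite, so each LBP run on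
the remaining graph returns `J_T⁻¹` times its potential. Gains and partial means are therefore
exact, `hatJ` is the Schur complement of `J_T` in `J`, and block elimination gives exact means
everywhere and the exact covariance on `F`. Off `F` the correction added to the partial variance is
exactly `J⁻¹ i i - J_T⁻¹ i i` (`fmpVar_eq_of_notMem`), so all the error lies in the partial
variance.

Partial variances. A backtracking walk splits uniquely into excursions to neighbours, so it is a
binary tree (`Excursion.exists_equiv_backtracking`), and its weight is a product of squares. Let `W
i par` be the sum over walks of `i` that never step to the parent at root level. Then `W = 1 + S *
W`, where `S` sums `R i k * R k i * W k (some i)` over the allowed neighbours. Inverse LBP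
precisions solve the same equation, which may have several solutions, so two comparisons are needed.
Sums truncated by height stay below the inverse of any positive fixed point
(`LBPConverges.excursionSum_le`). Iterates from nonnegative messages keep the precisions above `1 /
W` (`LBPConverges.inv_excursionSum_le`). Together they give equality.

Ordered walk-sums. Sums by length are linear functionals of partial Neumann sums. By Cayley–Hamilton
the inverse of `1 - A` is a polynomial in `A`, so the value of such a functional is forced as soon
as its sums converge, even if the matrix series diverges (`eq_of_tendsto_sum_pow`). -/

theorem cavityPrecision_congr {m m' : Messages V} {i : V}
    (hm : ∀ k, G.Adj k i → m.J k i = m'.J k i) (j : V) :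
    cavityPrecision G J m i j = cavityPrecision G J m' i j := by
  unfold cavityPrecision
  congr 1
  refine Finset.sum_congr rfl fun k hk => hm k ?_
  have := Finset.mem_of_mem_erase hk
  rw [SimpleGraph.mem_neighborFinset] at this
  exact this.symm

omit [DecidableEq V] in
theorem nodePrecision_congr {m m' : Messages V} {i : V}
    (hm : ∀ k, G.Adj k i → m.J k i = m'.J k i) :
    nodePrecision G J m i = nodePrecision G J m' i := by
  unfold nodePrecision
  congr 1
  refine Finset.sum_congr rfl fun k hk => hm k ?_
  rw [SimpleGraph.mem_neighborFinset] at hk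
  exact hk.symm

theorem nodePrecision_eq_cavity (m : Messages V) {i j : V} (hij : G.Adj i j) :
    nodePrecision G J m i = cavityPrecision G J m i j + m.J j i := by
  unfold nodePrecision cavityPrecision
  rw [← Finset.sum_erase_add _ _ ((G.mem_neighborFinset i j).2 hij), add_assoc]

theorem nodePotential_eq_cavity (m : Messages V) {i j : V} (hij : G.Adj i j) :
    nodePotential G h m i = cavityPotential G h m i j + m.h j i := by
  unfold nodePotential cavityPotential
  rw [← Finset.sum_erase_add _ _ ((G.mem_neighborFinset i j).2 hij), add_assoc]

/-- Message arrays that are fixed by the update on every edge, without zero denominators. -/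
structure IsFixedPoint (m : Messages V) : Prop where
  J_eq : ∀ i j, G.Adj i j → m.J i j = -(J j i * (cavityPrecision G J m i j)⁻¹ * J i j)
  h_eq : ∀ i j, G.Adj i j →
    m.h i j = -(J j i * (cavityPrecision G J m i j)⁻¹ * cavityPotential G h m i j)
  cavity_ne : ∀ i j, G.Adj i j → cavityPrecision G J m i j ≠ 0
  node_ne : ∀ i, nodePrecision G J m i ≠ 0

variable {G J h}

theorem LBPConverges.tendsto_lbpLimit {m₀ : Messages V} (hc : LBPConverges G J h m₀) {i j : V}
    (hij : G.Adj i j) :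
    Filter.Tendsto (fun t => (lbpIter G J h m₀ t).J i j) Filter.atTop
      (𝓝 ((lbpLimit G J h m₀).J i j)) ∧
    Filter.Tendsto (fun t => (lbpIter G J h m₀ t).h i j) Filter.atTop
      (𝓝 ((lbpLimit G J h m₀).h i j)) := by
  obtain ⟨m, hm, -⟩ := hc
  exact ⟨tendsto_nhds_limUnder ⟨_, (hm i j hij).1⟩, tendsto_nhds_limUnder ⟨_, (hm i j hij).2⟩⟩

theorem lbpIter_succ (m₀ : Messages V) (t : ℕ) :
    lbpIter G J h m₀ (t + 1) = lbpStep G J h (lbpIter G J h m₀ t) :=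
  Function.iterate_succ_apply' _ _ _

theorem LBPConverges.isFixedPoint {m₀ : Messages V} (hc : LBPConverges G J h m₀) :
    IsFixedPoint G J h (lbpLimit G J h m₀) := by
  have hlim := fun {i j : V} (hij : G.Adj i j) => hc.tendsto_lbpLimit hij
  obtain ⟨m, hm, hcav, hnode⟩ := hc
  have hJ : ∀ i j, G.Adj i j → (lbpLimit G J h m₀).J i j = m.J i j := fun i j hij =>
    tendsto_nhds_unique (hlim hij).1 (hm i j hij).1
  set l := lbpLimit G J h m₀
  have hcav' : ∀ i j, G.Adj i j → cavityPrecision G J l i j ≠ 0 := fun i j hij => by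
    rw [cavityPrecision_congr G J (fun k hk => hJ k i hk)]; exact hcav i j hij
  have tcav : ∀ i j, Filter.Tendsto (fun t => cavityPrecision G J (lbpIter G J h m₀ t) i j)
      Filter.atTop (𝓝 (cavityPrecision G J l i j)) := fun i j => by
    refine tendsto_const_nhds.add (tendsto_finsetSum _ fun k hk => (hlim ?_).1)
    have := Finset.mem_of_mem_erase hk
    rw [SimpleGraph.mem_neighborFinset] at this
    exact this.symm
  have tpot : ∀ i j, Filter.Tendsto (fun t => cavityPotential G h (lbpIter G J h m₀ t) i j)
      Filter.atTop (𝓝 (cavityPotential G h l i j)) := fun i j => by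
    refine tendsto_const_nhds.add (tendsto_finsetSum _ fun k hk => (hlim ?_).2)
    have := Finset.mem_of_mem_erase hk
    rw [SimpleGraph.mem_neighborFinset] at this
    exact this.symm
  refine ⟨fun i j hij => ?_, fun i j hij => ?_, hcav', fun i => ?_⟩
  · refine tendsto_nhds_unique ((Filter.tendsto_add_atTop_iff_nat 1).2 (hlim hij).1) ?_
    simp only [lbpIter_succ, lbpStep]
    exact ((tendsto_const_nhds.mul ((tcav i j).inv₀ (hcav' i j hij))).mul_const _).neg
  · refine tendsto_nhds_unique ((Filter.tendsto_add_atTop_iff_nat 1).2 (hlim hij).2) ?_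
    simp only [lbpIter_succ, lbpStep]
    exact ((tendsto_const_nhds.mul ((tcav i j).inv₀ (hcav' i j hij))).mul (tpot i j)).neg
  · rw [nodePrecision_congr G J (fun k hk => hJ k i hk)]; exact hnode i

/-- The means at a fixed point of LBP solve `J x = h`. -/
theorem IsFixedPoint.mulVec_eq {m : Messages V} (hm : IsFixedPoint G J h m) (hJ : J.IsSymm)
    (hG : ∀ i j, i ≠ j → (J i j ≠ 0 ↔ G.Adj i j)) :
    J *ᵥ (fun i => (nodePrecision G J m i)⁻¹ * nodePotential G h m i) = h := by
  set x : V → ℝ := fun i => (nodePrecision G J m i)⁻¹ * nodePotential G h m i with hx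
  have hx' : ∀ i, nodePrecision G J m i * x i = nodePotential G h m i := fun i => by
    simp only [hx]; rw [mul_inv_cancel_left₀ (hm.node_ne i)]
  -- The bracket on the left is the defect of the claim `key` on the edge from `k` to `i`. The
  -- belief equation at `k` and the two update equations, cleared of denominators, tie it to the
  -- defect of the opposite direction.
  have half : ∀ i k, G.Adj i k →
      cavityPrecision G J m k i * (m.J k i * x i - m.h k i - J i k * x k) =
        J i k * (m.J i k * x k - m.h i k - J i k * x i) := fun i k hik => by
    have h1 := hx' k
    rw [nodePrecision_eq_cavity G J m hik.symm, nodePotential_eq_cavity G h m hik.symm] at h1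
    have hc := hm.cavity_ne k i hik.symm
    have e1 : cavityPrecision G J m k i * m.J k i = - (J i k * J i k) := by
      rw [hm.J_eq k i hik.symm, hJ.apply i k]; field_simp
    have e2 : cavityPrecision G J m k i * m.h k i = - (J i k * cavityPotential G h m k i) := by
      rw [hm.h_eq k i hik.symm]; field_simp
    linear_combination x i * e1 - e2 - J i k * h1
  have key : ∀ i k, G.Adj i k → m.J k i * x i - m.h k i = J i k * x k := fun i k hik => by
    have a1 := half i k hik
    have a2 := half k i hik.symm
    rw [hJ.apply i k] at a2
    have hc := hm.cavity_ne k i hik.symm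
    have hn := hm.node_ne i
    have e1 : cavityPrecision G J m k i * m.J k i = - (J i k * J i k) := by
      rw [hm.J_eq k i hik.symm, hJ.apply i k]; field_simp
    rw [nodePrecision_eq_cavity G J m hik] at hn
    -- Eliminating the opposite defect leaves this one multiplied by a cavity precision and the node
    -- precision of `i`, both nonzero.
    have : (cavityPrecision G J m k i * (cavityPrecision G J m i k + m.J k i)) *
        (m.J k i * x i - m.h k i - J i k * x k) = 0 := by
      linear_combination cavityPrecision G J m i k * a1 + J i k * a2 +
        (m.J k i * x i - m.h k i - J i k * x k) * e1
    rcases mul_eq_zero.1 this with h0 | h0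
    · exact absurd h0 (mul_ne_zero hc hn)
    · linarith
  funext i
  have h1 := hx' i
  unfold nodePrecision nodePotential at h1
  have h2 : (J *ᵥ x) i = J i i * x i + ∑ k ∈ G.neighborFinset i, J i k * x k := by
    rw [Matrix.mulVec, dotProduct, ← Finset.add_sum_erase _ _ (Finset.mem_univ i)]
    congr 1
    symm
    refine Finset.sum_subset (fun k hk => ?_) fun k hk hk' => ?_
    · rw [SimpleGraph.mem_neighborFinset] at hk
      simp [hk.ne']
    · rw [SimpleGraph.mem_neighborFinset] at hk'
      have : J i k = 0 := by
        by_contra h0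
        exact hk' ((hG i k (Finset.ne_of_mem_erase hk).symm).1 h0)
      rw [this, zero_mul]
  rw [h2, Finset.sum_congr rfl fun k hk =>
    (key i k ((G.mem_neighborFinset i k).1 hk)).symm, Finset.sum_sub_distrib, ← Finset.sum_mul]
  linarith

theorem LBPConverges.lbpMean_eq {m₀ : Messages V} (hc : LBPConverges G J h m₀) (hJ : J.PosDef)
    (hG : ∀ i j, i ≠ j → (J i j ≠ 0 ↔ G.Adj i j)) :
    lbpMean G J h m₀ = J⁻¹ *ᵥ h := by
  have hsymm : J.IsSymm := by simpa [Matrix.IsHermitian, Matrix.IsSymm] using hJ.1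
  have hx := hc.isFixedPoint.mulVec_eq hsymm hG
  have hdet : IsUnit J.det := (Matrix.isUnit_iff_isUnit_det _).1 hJ.isUnit
  conv_rhs => rw [← hx]
  rw [Matrix.mulVec_mulVec, Matrix.nonsing_inv_mul _ hdet, Matrix.one_mulVec]
  rfl

end FixedPoint

/-! ### Block elimination of the remaining nodes -/

section Block

variable {V : Type*} [Fintype V] [DecidableEq V]

theorem sum_eq_sum_mem_add_sum_rest (F : Finset V) (f : V → ℝ) :
    ∑ v, f v = ∑ p : F, f p + ∑ i : Rest F, f i := by
  rw [← Fintype.sum_subtype_add_sum_subtype (· ∈ F) f]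
  congr!

variable {J : Matrix V V ℝ}

omit [Fintype V] [DecidableEq V] in
theorem restJ_posDef (hJ : J.PosDef) (F : Finset V) : (restJ J F).PosDef :=
  hJ.submatrix Subtype.val_injective

/-- Block elimination: if `J X = Y` column by column, the rest block of `X` is determined by its
feedback block. -/
theorem rest_eq_of_mulVec_eq (hJ : J.PosDef) (F : Finset V) {x y : V → ℝ} (hxy : J *ᵥ x = y) :
    (fun i : Rest F => x i) = (restJ J F)⁻¹ *ᵥ (fun i : Rest F => y i - ∑ p : F, J i p * x p) := by
  have hdet : IsUnit (restJ J F).det :=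
    (Matrix.isUnit_iff_isUnit_det _).1 (restJ_posDef hJ F).isUnit
  have : (fun i : Rest F => y i - ∑ p : F, J i p * x p) = restJ J F *ᵥ fun i : Rest F => x i := by
    funext i
    have := congrFun hxy i
    rw [Matrix.mulVec, dotProduct, sum_eq_sum_mem_add_sum_rest F] at this
    simp only [Matrix.mulVec, dotProduct, Matrix.submatrix_apply]
    linarith
  rw [this, Matrix.mulVec_mulVec, Matrix.nonsing_inv_mul _ hdet, Matrix.one_mulVec]

/-- Elimination with the feedback block split off by linearity: the coefficients of the `x p` are
the exact values that the feedback gains must take. -/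
theorem rest_apply_of_mulVec_eq (hJ : J.PosDef) (F : Finset V) {x y : V → ℝ} (hxy : J *ᵥ x = y)
    (i : Rest F) :
    x i = ((restJ J F)⁻¹ *ᵥ fun j : Rest F => y j) i -
      ∑ p : F, ((restJ J F)⁻¹ *ᵥ extraPotential J F p) i * x p := by
  have h1 : x i = _ := congrFun (rest_eq_of_mulVec_eq hJ F hxy) i
  rw [h1]
  simp only [Matrix.mulVec, dotProduct, extraPotential, mul_sub, Finset.sum_sub_distrib,
    Finset.mul_sum, Finset.sum_mul]
  rw [Finset.sum_comm]
  simp only [mul_assoc]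

variable (G : SimpleGraph V) [DecidableRel G.Adj] {F : Finset V}

omit [Fintype V] [DecidableEq V] [DecidableRel G.Adj] in
theorem restGraph_adj_iff (hG : ∀ i j, i ≠ j → (J i j ≠ 0 ↔ G.Adj i j)) :
    ∀ i j : Rest F, i ≠ j → (restJ J F i j ≠ 0 ↔ (restGraph G F).Adj i j) := fun i j hij =>
  hG i j fun h => hij (Subtype.ext h)

variable {G}

/-- Entries of `J` vanish off the edges, so restricting a sum to neighbours changes nothing. -/
theorem sum_filter_adj_rest (hG : ∀ i j, i ≠ j → (J i j ≠ 0 ↔ G.Adj i j)) (p : F)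
    (f : Rest F → ℝ) :
    Finset.sum (Finset.univ.filter fun j : Rest F => G.Adj p j) (fun j : Rest F => J p j * f j) =
      ∑ j : Rest F, J p j * f j := by
  refine Finset.sum_filter_of_ne fun j _ hj => (hG p j fun h => j.2 (h ▸ p.2)).1 ?_
  exact left_ne_zero_of_mul hj

omit [Fintype V] [DecidableEq V] in
theorem sum_filter_adj_feedback (hG : ∀ i j, i ≠ j → (J i j ≠ 0 ↔ G.Adj i j)) (i : Rest F)
    (f : F → ℝ) :
    Finset.sum (Finset.univ.filter fun j : F => G.Adj i j) (fun j : F => J i j * f j) =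
      ∑ j : F, J i j * f j := by
  refine Finset.sum_filter_of_ne fun j _ hj => (hG i j fun h => i.2 (h ▸ j.2)).1 ?_
  exact left_ne_zero_of_mul hj

end Block

/-! ### Exactness of the means and of the feedback covariance -/

section Exact

variable {V : Type*} [Fintype V] [DecidableEq V] {G : SimpleGraph V} [DecidableRel G.Adj]
  {J : Matrix V V ℝ} {h : V → ℝ} {F : Finset V} {ini : FMPInit F}

theorem partialMean_eq (hJ : J.PosDef) (hG : ∀ i j, i ≠ j → (J i j ≠ 0 ↔ G.Adj i j))
    (hc : FMPConverges G J h F ini) :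
    partialMean G J h F ini = (restJ J F)⁻¹ *ᵥ restPotential h F :=
  hc.1.lbpMean_eq (restJ_posDef hJ F) (restGraph_adj_iff G hG)

theorem feedbackGain_eq (hJ : J.PosDef) (hG : ∀ i j, i ≠ j → (J i j ≠ 0 ↔ G.Adj i j))
    (hc : FMPConverges G J h F ini) (p : F) :
    feedbackGain G J F ini p = (restJ J F)⁻¹ *ᵥ extraPotential J F p :=
  (hc.2.1 p).lbpMean_eq (restJ_posDef hJ F) (restGraph_adj_iff G hG)

theorem hatJ_apply (hJ : J.PosDef) (hG : ∀ i j, i ≠ j → (J i j ≠ 0 ↔ G.Adj i j))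
    (hc : FMPConverges G J h F ini) (p q : F) :
    hatJ G J F ini p q =
      J p q - ∑ j : Rest F, J p j * ((restJ J F)⁻¹ *ᵥ extraPotential J F q) j := by
  rw [← feedbackGain_eq hJ hG hc, ← sum_filter_adj_rest hG]
  rfl

/-- The reduced system on the feedback nodes is the Schur complement of the full one. -/
theorem hatJ_mulVec (hJ : J.PosDef) (hG : ∀ i j, i ≠ j → (J i j ≠ 0 ↔ G.Adj i j))
    (hc : FMPConverges G J h F ini) {x y : V → ℝ} (hxy : J *ᵥ x = y) (p : F) :
    (hatJ G J F ini *ᵥ fun q : F => x q) p =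
      y p - ∑ j : Rest F, J p j * ((restJ J F)⁻¹ *ᵥ fun j : Rest F => y j) j := by
  have h1 := congrFun hxy p
  rw [Matrix.mulVec, dotProduct, sum_eq_sum_mem_add_sum_rest F,
    Finset.sum_congr rfl fun (j : Rest F) _ =>
      congrArg (J p j * ·) (rest_apply_of_mulVec_eq hJ F hxy j)] at h1
  simp only [Matrix.mulVec, dotProduct, hatJ_apply hJ hG hc, sub_mul, Finset.sum_sub_distrib,
    mul_sub, Finset.mul_sum,
    Finset.sum_mul] at h1 ⊢
  rw [Finset.sum_comm (s := (Finset.univ : Finset F))]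
  simp only [mul_assoc] at h1 ⊢
  have e : ∑ j : Rest F, ∑ q : F, ∑ k : Rest F, J p j * ((restJ J F)⁻¹ j k *
      (extraPotential J F q k * x q)) = ∑ j : Rest F, ∑ q : F, J p j * ∑ k : Rest F,
        ((restJ J F)⁻¹ j k * (extraPotential J F q k * x q)) := by
    simp only [Finset.mul_sum]
  linarith

theorem mulVec_inv_col (hJ : J.PosDef) (v : V) :
    J *ᵥ (fun u => J⁻¹ u v) = Pi.single v 1 := by
  have hdet : IsUnit J.det := (Matrix.isUnit_iff_isUnit_det _).1 hJ.isUnit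
  have : (fun u => J⁻¹ u v) = J⁻¹ *ᵥ Pi.single v 1 := by
    rw [Matrix.mulVec_single_one]; rfl
  rw [this, Matrix.mulVec_mulVec, Matrix.mul_nonsing_inv _ hdet, Matrix.one_mulVec]

/-- A column of `J⁻¹` indexed by `q` in `F` solves a system whose right side vanishes on the
remaining nodes, so the reduced system has a unit vector on its right side. -/
theorem hatJ_mul (hJ : J.PosDef) (hG : ∀ i j, i ≠ j → (J i j ≠ 0 ↔ G.Adj i j))
    (hc : FMPConverges G J h F ini) :
    hatJ G J F ini * J⁻¹.submatrix Subtype.val Subtype.val = 1 := by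
  ext p q
  have h1 := hatJ_mulVec hJ hG hc (mulVec_inv_col hJ (q : V)) p
  have h2 : (fun j : Rest F => (Pi.single (q : V) 1 : V → ℝ) j) = 0 := by
    funext j
    simp [show (j : V) ≠ q from fun h => j.2 (h ▸ q.2)]
  rw [h2, Matrix.mulVec_zero] at h1
  simp only [Pi.zero_apply, mul_zero, Finset.sum_const_zero, sub_zero, Pi.single_apply,
    ← Subtype.ext_iff] at h1
  rw [Matrix.one_apply, ← h1]
  rfl

/-- The covariance computed on the feedback nodes is exact. -/
theorem feedbackCov_eq (hJ : J.PosDef) (hG : ∀ i j, i ≠ j → (J i j ≠ 0 ↔ G.Adj i j))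
    (hc : FMPConverges G J h F ini) :
    feedbackCov G J F ini = J⁻¹.submatrix Subtype.val Subtype.val :=
  Matrix.inv_eq_right_inv (hatJ_mul hJ hG hc)

theorem mulVec_mean (hJ : J.PosDef) : J *ᵥ (J⁻¹ *ᵥ h) = h := by
  rw [Matrix.mulVec_mulVec, Matrix.mul_nonsing_inv _
    ((Matrix.isUnit_iff_isUnit_det _).1 hJ.isUnit), Matrix.one_mulVec]

/-- The means computed on the feedback nodes are exact. -/
theorem feedbackMean_eq (hJ : J.PosDef) (hG : ∀ i j, i ≠ j → (J i j ≠ 0 ↔ G.Adj i j))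
    (hc : FMPConverges G J h F ini) :
    feedbackMean G J h F ini = fun p : F => (J⁻¹ *ᵥ h) p := by
  have h1 : hatPotential G J h F ini = hatJ G J F ini *ᵥ fun p : F => (J⁻¹ *ᵥ h) p := by
    funext p
    rw [hatJ_mulVec hJ hG hc (mulVec_mean hJ), hatPotential, sum_filter_adj_rest hG,
      partialMean_eq hJ hG hc]
  have h2 : IsUnit (hatJ G J F ini).det :=
    Matrix.isUnit_det_of_right_inverse (hatJ_mul hJ hG hc)
  rw [feedbackMean, h1, Matrix.mulVec_mulVec, Matrix.nonsing_inv_mul _ h2, Matrix.one_mulVec]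

theorem fmpMean_eq (hJ : J.PosDef) (hG : ∀ i j, i ≠ j → (J i j ≠ 0 ↔ G.Adj i j))
    (hc : FMPConverges G J h F ini) (i : V) :
    fmpMean G J h F ini i = (J⁻¹ *ᵥ h) i := by
  unfold fmpMean
  split_ifs with hi
  · rw [feedbackMean_eq hJ hG hc]
  · rw [hc.2.2.lbpMean_eq (restJ_posDef hJ F) (restGraph_adj_iff G hG)]
    have h1 : (J⁻¹ *ᵥ h) i = _ :=
      congrFun (rest_eq_of_mulVec_eq hJ F (mulVec_mean (h := h) hJ)) ⟨i, hi⟩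
    have h2 : revisedPotential G J h F ini =
        fun i : Rest F => h i - ∑ p : F, J i p * (J⁻¹ *ᵥ h) p := by
      funext j
      rw [revisedPotential, sum_filter_adj_feedback hG, feedbackMean_eq hJ hG hc]
    rw [h1, h2]

theorem fmpVar_eq_of_mem (hJ : J.PosDef) (hG : ∀ i j, i ≠ j → (J i j ≠ 0 ↔ G.Adj i j))
    (hc : FMPConverges G J h F ini) {i : V} (hi : i ∈ F) :
    fmpVar G J h F ini i = J⁻¹ i i := by
  rw [fmpVar, dif_pos hi, feedbackCov_eq hJ hG hc]
  rfl

/-- Outside the feedback nodes, the only error of the computed variances is the error of the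
partial variances. -/
theorem fmpVar_eq_of_notMem (hJ : J.PosDef) (hG : ∀ i j, i ≠ j → (J i j ≠ 0 ↔ G.Adj i j))
    (hc : FMPConverges G J h F ini) {i : V} (hi : i ∉ F) :
    fmpVar G J h F ini i = partialVar G J h F ini ⟨i, hi⟩ +
      (J⁻¹ i i - (restJ J F)⁻¹ ⟨i, hi⟩ ⟨i, hi⟩) := by
  have hsymm : J⁻¹.IsSymm := by
    have := hJ.1.inv
    simpa [Matrix.IsHermitian, Matrix.IsSymm] using this
  have zero_on_rest : ∀ q : F, (fun j : Rest F => (Pi.single (q : V) 1 : V → ℝ) j) = 0 :=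
      fun q => by
    funext j
    simp [show (j : V) ≠ q from fun h => j.2 (h ▸ q.2)]
  -- Cross-covariances are feedback covariances propagated by the gains; using this once for rows
  -- and once, by symmetry, for columns produces the quadratic form in the gains.
  have h1 : ∀ q : F, J⁻¹ i q = -∑ p : F, feedbackGain G J F ini p ⟨i, hi⟩ * J⁻¹ p q := fun q => by
    have := rest_apply_of_mulVec_eq hJ F (mulVec_inv_col hJ (q : V)) ⟨i, hi⟩
    rw [zero_on_rest, Matrix.mulVec_zero] at this
    simp only [feedbackGain_eq hJ hG hc]
    simpa using this
  have h2 := rest_apply_of_mulVec_eq hJ F (mulVec_inv_col hJ i) ⟨i, hi⟩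
  have h3 : (fun j : Rest F => (Pi.single i 1 : V → ℝ) j) = Pi.single ⟨i, hi⟩ 1 := by
    funext j
    simp [Pi.single_apply, Subtype.ext_iff]
  rw [h3] at h2
  simp only [Matrix.mulVec_single_one, Matrix.col_apply] at h2
  rw [fmpVar, dif_neg hi, feedbackCov_eq hJ hG hc, add_right_inj, eq_sub_iff_add_eq]
  rw [h2]
  have h4 : ∀ q : F, J⁻¹ q i = -∑ p : F, feedbackGain G J F ini p ⟨i, hi⟩ * J⁻¹ p q := fun q => by
    rw [hsymm.apply i q, h1]
  simp only [h4, ← feedbackGain_eq hJ hG hc, Matrix.submatrix_apply]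
  rw [Finset.sum_comm]
  simp only [mul_neg, Finset.sum_neg_distrib, sub_neg_eq_add, Finset.mul_sum]
  rw [add_comm]
  congr 1
  exact Finset.sum_congr rfl fun p _ => Finset.sum_congr rfl fun q _ => by ring

end Exact

/-! ### Backtracking walks as trees of excursions -/

/-- Binary encoding of closed walks in a tree: an excursion to a neighbour `k`, with a closed walk
`a` of `k` inside it, followed by a closed walk `b`. -/
inductive Excursion (V : Type*)
  | nil : Excursion V
  | cons (k : V) (a b : Excursion V) : Excursion V

namespace Excursion

variable {V : Type*}

/-- The vertices visited after the start `i`. -/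
def trace (i : V) : Excursion V → List V
  | nil => []
  | cons k a b => k :: (a.trace k ++ i :: b.trace i)

/-- The excursions go along edges of `G` and never step back to the parent at root level. -/
def Valid (G : SimpleGraph V) : V → Option V → Excursion V → Prop
  | _, _, nil => True
  | i, par, cons k a b => (G.Adj i k ∧ par ≠ some k) ∧ a.Valid G k (some i) ∧ b.Valid G i par

theorem Valid.mono {G : SimpleGraph V} {i : V} {par : Option V} {t : Excursion V}
    (h : t.Valid G i par) : t.Valid G i none := by
  induction t with
  | nil => trivial
  | cons k a b _ ihb => exact ⟨⟨h.1.1, by simp⟩, h.2.1, ihb h.2.2⟩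

/-- A valid encoding can be read off from its trace. -/
theorem trace_append_injective {G : SimpleGraph V} {t t' : Excursion V} {i : V} {par : Option V}
    {r r' : List V} (ht : t.Valid G i par) (ht' : t'.Valid G i par) (hr : r.head? = par)
    (hr' : r'.head? = par) (h : t.trace i ++ r = t'.trace i ++ r') : t = t' ∧ r = r' := by
  -- The remainder starts with the parent or, without a parent, is empty. A valid encoding has no
  -- such next child, so the end of each level can be recognised in the trace; inside an excursion
  -- from `i` the remainder starts with `i`.
  induction t generalizing i par r r' t' with
  | nil =>
    cases t' with
    | nil => exact ⟨rfl, by simpa [trace] using h⟩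
    | cons k a b =>
      simp only [trace, List.nil_append] at h
      rw [h] at hr
      exact absurd hr.symm ht'.1.2
  | cons k a b iha ihb =>
    cases t' with
    | nil =>
      simp only [trace, List.nil_append] at h
      rw [← h] at hr'
      exact absurd hr'.symm ht.1.2
    | cons k' a' b' =>
      simp only [trace, List.cons_append, List.append_assoc, List.cons.injEq] at h
      obtain ⟨rfl, h₁⟩ := h
      obtain ⟨rfl, h₂⟩ := iha ht.2.1 ht'.2.1 (by simp) (by simp) h₁
      obtain ⟨rfl, h₃⟩ := ihb ht.2.2 ht'.2.2 hr hr' (List.cons.inj h₂).2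
      exact ⟨rfl, h₃⟩

theorem trace_injOn (G : SimpleGraph V) (i : V) : Set.InjOn (trace i) {t | t.Valid G i none} :=
  fun t ht t' ht' h => (trace_append_injective (r := []) (r' := []) ht ht' rfl rfl (by simpa)).1

/-- Any backtracking excursion can be contracted inside a longer list. -/
theorem reduces (t : Excursion V) (i : V) (l₁ l₂ : List V) :
    Relation.ReflTransGen BacktrackStep (l₁ ++ i :: (t.trace i ++ l₂)) (l₁ ++ i :: l₂) := by
  induction t generalizing i l₁ l₂ with
  | nil => exact .refl
  | cons k a b iha ihb =>
    have h1 := iha k (l₁ ++ [i]) (i :: (b.trace i ++ l₂))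
    have h2 : BacktrackStep (l₁ ++ [i] ++ k :: i :: (b.trace i ++ l₂))
        (l₁ ++ i :: (b.trace i ++ l₂)) := ⟨l₁, b.trace i ++ l₂, i, k, by simp, rfl⟩
    have h3 := h1.trans (.head h2 (ihb i l₁ l₂))
    simpa [trace] using h3

/-- Concatenation of closed walks. -/
def append : Excursion V → Excursion V → Excursion V
  | nil, t => t
  | cons k a b, t => cons k a (b.append t)

theorem trace_append (s t : Excursion V) (i : V) :
    (s.append t).trace i = s.trace i ++ t.trace i := by
  induction s with
  | nil => rfl
  | cons k a b _ ihb => simp [append, trace, ihb]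

/-- Undoes one reduction: the spur `a, b, a` is grafted onto the tree as a leaf excursion at the
chosen occurrence of `a`. Validity is not tracked here. -/
theorem exists_trace_of_insert (t : Excursion V) {i a : V} (b : V) {l₁ l₂ : List V}
    (h : i :: t.trace i = l₁ ++ a :: l₂) :
    ∃ s : Excursion V, i :: s.trace i = l₁ ++ a :: b :: a :: l₂ := by
  induction t generalizing i l₁ l₂ with
  | nil =>
    cases l₁ with
    | nil =>
      obtain ⟨rfl, rfl⟩ := List.cons.inj h
      exact ⟨cons b nil nil, rfl⟩
    | cons c l => simp [trace] at h
  | cons k u v ihu ihv =>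
    cases l₁ with
    | nil =>
      obtain ⟨rfl, rfl⟩ := List.cons.inj h
      exact ⟨cons b nil (cons k u v), rfl⟩
    | cons c l =>
      obtain ⟨rfl, h₁⟩ := List.cons.inj h
      rw [trace, ← List.cons_append] at h₁
      rcases List.append_eq_append_iff.1 h₁ with ⟨x, rfl, hx⟩ | ⟨x, hx, hx'⟩
      · obtain ⟨s, hs⟩ := ihv hx
        exact ⟨cons k u s, by simp [trace, hs]⟩
      -- An empty `x` is the boundary case: the chosen occurrence is the return to the root after
      -- the excursion, so the spur belongs to the second subtree.
      · cases x with
        | nil =>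
          obtain ⟨s, hs⟩ := ihv (l₁ := []) hx'.symm
          simp only [List.append_nil] at hx
          exact ⟨cons k u s, by simp [trace, hs, ← hx]⟩
        | cons y x =>
          simp only [List.cons_append, List.cons.injEq] at hx'
          obtain ⟨rfl, rfl⟩ := hx'
          obtain ⟨s, hs⟩ := ihu hx
          refine ⟨cons k s v, ?_⟩
          rw [trace, ← List.cons_append, hs]
          simp

theorem exists_trace_of_reflTransGen {i : V} {l : List V}
    (h : Relation.ReflTransGen BacktrackStep l [i]) :
    ∃ t : Excursion V, i :: t.trace i = l := by
  induction h using Relation.ReflTransGen.head_induction_on with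
  | refl => exact ⟨nil, rfl⟩
  | head hstep _ ih =>
    obtain ⟨l₁, l₂, a, b, rfl, rfl⟩ := hstep
    obtain ⟨t, ht⟩ := ih
    exact exists_trace_of_insert t b ht

variable {G : SimpleGraph V}

theorem Valid.append {s t : Excursion V} {i : V} {par : Option V} (hs : s.Valid G i par)
    (ht : t.Valid G i par) : (s.append t).Valid G i par := by
  induction s with
  | nil => exact ht
  | cons k a b _ ihb => exact ⟨hs.1, hs.2.1, ihb hs.2.2⟩

/-- A closed walk either never steps to `p` at root level or splits at its first such step. -/
theorem Valid.split {t : Excursion V} {k : V} (ht : t.Valid G k none) (p : V) :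
    t.Valid G k (some p) ∨ ∃ t₀ e t₁ : Excursion V, t₀.Valid G k (some p) ∧
      e.Valid G p (some k) ∧ t₁.Valid G k none ∧
      t.trace k = t₀.trace k ++ p :: (e.trace p ++ k :: t₁.trace k) := by
  classical
  induction t with
  | nil => exact .inl trivial
  | cons c a b _ ihb =>
    by_cases hc : p = c
    · subst hc
      exact .inr ⟨nil, a, b, trivial, ht.2.1, ht.2.2, rfl⟩
    · rcases ihb ht.2.2 with hb | ⟨t₀, e, t₁, h₀, he, h₁, h⟩
      · exact .inl ⟨⟨ht.1.1, by simpa using hc⟩, ht.2.1, hb⟩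
      · exact .inr ⟨cons c a t₀, e, t₁, ⟨⟨ht.1.1, by simpa using hc⟩, ht.2.1, h₀⟩, he, h₁,
          by simp [trace, h]⟩

/-- Re-bracketing makes any encoding valid: when the inner walk of an excursion steps back to its
parent, the excursion is closed there and the rest becomes part of the parent's level. The pieces
are not subtrees of the original, hence induction on trace length. -/
theorem exists_valid_of_length (n : ℕ) : ∀ (t : Excursion V) (i : V), (t.trace i).length ≤ n →
    (i :: t.trace i).IsChain G.Adj →
    ∃ s : Excursion V, s.Valid G i none ∧ s.trace i = t.trace i := by
  induction n with
  | zero =>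
    intro t i hl _
    cases t with
    | nil => exact ⟨nil, trivial, rfl⟩
    | cons k a b => simp [trace] at hl
  | succ n ih =>
    intro t i hl hch
    cases t with
    | nil => exact ⟨nil, trivial, rfl⟩
    | cons k a b =>
      simp only [trace, List.length_cons, List.length_append] at hl
      have hik : G.Adj i k := by
        simp only [trace, List.isChain_cons_cons] at hch
        exact hch.1
      have hch' : (k :: a.trace k ++ i :: b.trace i).IsChain G.Adj := by
        simp only [trace, List.isChain_cons_cons] at hch
        exact hch.2
      obtain ⟨a', ha', hta⟩ := ih a k (by omega) hch'.left_of_append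
      obtain ⟨b', hb', htb⟩ := ih b i (by omega) hch'.right_of_append
      rcases ha'.split i with hv | ⟨t₀, e, t₁, h₀, he, h₁, h⟩
      · exact ⟨cons k a' b', ⟨⟨hik, by simp⟩, hv, hb'⟩, by simp [trace, hta, htb]⟩
      -- The walk from `i` through `k` is cut at its first step back to `i`: first `t₀` inside `k`,
      -- then `e` at `i`, then a new excursion to `k` along `t₁`, then the old remainder.
      · have hsplit : (k :: t₀.trace k ++ i :: e.trace i) ++ (k :: t₁.trace k ++ i :: b.trace i) =
            k :: a.trace k ++ i :: b.trace i := by simp [← hta, h]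
        rw [← hta, h] at hl
        simp only [List.length_append, List.length_cons] at hl
        have hc₁ : (i :: (cons k t₁ b).trace i).IsChain G.Adj := by
          rw [← hsplit] at hch'
          exact List.isChain_cons_cons.2 ⟨hik, hch'.right_of_append⟩
        obtain ⟨c, hc, htc⟩ := ih (cons k t₁ b) i (by simp [trace]; omega) hc₁
        refine ⟨cons k t₀ (e.append c), ⟨⟨hik, by simp⟩, h₀, he.mono.append hc⟩, ?_⟩
        simp [trace, trace_append, htc, ← hta, h]

/-- The product of the edge weights along an excursion; each edge is traversed once in each direction. -/
def weight (R : Matrix V V ℝ) (i : V) : Excursion V → ℝ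
  | nil => 1
  | cons k a b => R i k * R k i * a.weight R k * b.weight R i

/-- By symmetry of `R`, going along an edge and back contributes a square; this permits sums in
`ℝ≥0∞`. -/
theorem weight_nonneg {R : Matrix V V ℝ} (hR : R.IsSymm) (i : V) (t : Excursion V) :
    0 ≤ t.weight R i := by
  induction t generalizing i with
  | nil => exact zero_le_one
  | cons k a b iha ihb =>
    rw [weight, hR.apply i k]
    exact mul_nonneg (mul_nonneg (mul_self_nonneg _) (iha k)) (ihb i)

theorem _root_.GaussFMP.walkWeight_cons (R : Matrix V V ℝ) {i j k : V} (h : G.Adj i j)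
    (w : G.Walk j k) : walkWeight R (.cons h w) = R i j * walkWeight R w := by
  simp [walkWeight]

theorem _root_.GaussFMP.walkWeight_append (R : Matrix V V ℝ) {i j k : V} (w : G.Walk i j)
    (w' : G.Walk j k) : walkWeight R (w.append w') = walkWeight R w * walkWeight R w' := by
  simp [walkWeight]

theorem Valid.exists_walk (R : Matrix V V ℝ) {t : Excursion V} {i : V} {par : Option V}
    (ht : t.Valid G i par) :
    ∃ w : G.Walk i i, w.support = i :: t.trace i ∧ walkWeight R w = t.weight R i := by
  induction t generalizing i par with
  | nil => exact ⟨.nil, rfl, by simp [walkWeight, weight]⟩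
  | cons k a b iha ihb =>
    obtain ⟨wa, hwa, hwa'⟩ := iha ht.2.1
    obtain ⟨wb, hwb, hwb'⟩ := ihb ht.2.2
    refine ⟨.cons ht.1.1 (wa.append (.cons ht.1.1.symm wb)), ?_, ?_⟩
    · simp [SimpleGraph.Walk.support_append, hwa, hwb, trace]
    · rw [walkWeight_cons, walkWeight_append, walkWeight_cons, hwa', hwb', weight]
      ring

/-- Backtracking walks of `i` are uniquely encoded by valid excursions. -/
theorem exists_equiv_backtracking (G : SimpleGraph V) (R : Matrix V V ℝ) (i : V) :
    ∃ e : {t : Excursion V // t.Valid G i none} ≃ {w : G.Walk i i // IsBacktracking w},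
      ∀ t, walkWeight R (e t : G.Walk i i) = t.1.weight R i := by
  choose w hw hw' using fun t : {t : Excursion V // t.Valid G i none} => t.2.exists_walk R
  have hb : ∀ t, IsBacktracking (w t) := fun t => by
    have := reduces t.1 i [] []
    simpa [IsBacktracking, hw t] using this
  refine ⟨Equiv.ofBijective (fun t => ⟨w t, hb t⟩) ⟨fun t t' h => ?_, fun v => ?_⟩, hw'⟩
  · refine Subtype.ext (trace_injOn G i t.2 t'.2 ?_)
    have := congrArg SimpleGraph.Walk.support (Subtype.mk.inj h)
    rw [hw, hw] at this
    exact (List.cons.inj this).2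
  · obtain ⟨t, ht⟩ := exists_trace_of_reflTransGen v.2
    obtain ⟨s, hs, hst⟩ := exists_valid_of_length (G := G) _ t i le_rfl
      (ht ▸ v.1.isChain_adj_support)
    refine ⟨⟨s, hs⟩, Subtype.ext (SimpleGraph.Walk.ext_support ?_)⟩
    rw [hw, ← ht, hst]

end Excursion

/-! ### Excursion sums and their recursion -/

open scoped ENNReal

namespace Excursion

variable {V : Type*}

/-- The encoding as a recursive type. -/
def equivSum (V : Type*) : Unit ⊕ (V × Excursion V × Excursion V) ≃ Excursion V where
  toFun
    | .inl _ => nil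
    | .inr (k, a, b) => cons k a b
  invFun
    | nil => .inl ()
    | cons k a b => .inr (k, a, b)
  left_inv := by rintro (_ | ⟨k, a, b⟩) <;> rfl
  right_inv := by rintro (_ | ⟨k, a, b⟩) <;> rfl

theorem tsum_eq [Fintype V] (f : Excursion V → ℝ≥0∞) :
    ∑' t, f t = f nil + ∑ k, ∑' a, ∑' b, f (cons k a b) := by
  rw [← (equivSum V).tsum_eq, Summable.tsum_sum ENNReal.summable ENNReal.summable]
  congr 1
  · simp [equivSum]
  · simp only [equivSum, Equiv.coe_fn_mk]
    rw [ENNReal.tsum_prod', tsum_fintype]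
    simp_rw [ENNReal.tsum_prod']

end Excursion

section Branching

variable {V : Type*} [Fintype V] [DecidableEq V] (G : SimpleGraph V) [DecidableRel G.Adj]

/-- The neighbours of `i` other than its parent. -/
def children (i : V) (par : Option V) : Finset V :=
  Finset.univ.filter fun k => G.Adj i k ∧ par ≠ some k

theorem mem_children {i k : V} {par : Option V} :
    k ∈ children G i par ↔ G.Adj i k ∧ par ≠ some k := by
  simp [children]

theorem children_none (i : V) : children G i none = G.neighborFinset i := by
  ext k; simp [mem_children]

theorem children_some (i j : V) : children G i (some j) = (G.neighborFinset i).erase j := by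
  ext k; simp [mem_children, and_comm, eq_comm]

/-- The node precision and the cavity precisions in one function. -/
def precision (J : Matrix V V ℝ) (m : Messages V) (i : V) (par : Option V) : ℝ :=
  J i i + ∑ k ∈ children G i par, m.J k i

theorem precision_none (J : Matrix V V ℝ) (m : Messages V) (i : V) :
    precision G J m i none = nodePrecision G J m i := by
  rw [precision, children_none, nodePrecision]

theorem precision_some (J : Matrix V V ℝ) (m : Messages V) (i j : V) :
    precision G J m i (some j) = cavityPrecision G J m i j := by
  rw [precision, children_some, cavityPrecision]

variable (R : Matrix V V ℝ)

/-- The weight of going to a child and back. -/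
def edgeTerm (i : V) (par : Option V) (k : V) : ℝ≥0∞ :=
  if k ∈ children G i par then ENNReal.ofReal (R i k * R k i) else 0

/-- The weight of an excursion, zero if it is invalid. -/
def excursionTerm : V → Option V → Excursion V → ℝ≥0∞
  | _, _, .nil => 1
  | i, par, .cons k a b =>
    edgeTerm G R i par k * (excursionTerm k (some i) a * excursionTerm i par b)

/-- The weight of an excursion, zero if it is invalid or has height at least `n`. -/
def truncatedTerm : ℕ → V → Option V → Excursion V → ℝ≥0∞
  | 0, _, _, _ => 0
  | _ + 1, _, _, .nil => 1
  | n + 1, i, par, .cons k a b =>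
    edgeTerm G R i par k * (truncatedTerm n k (some i) a * truncatedTerm n i par b)

/-- The sum of the weights of all valid excursions. -/
def excursionSum (i : V) (par : Option V) : ℝ≥0∞ := ∑' t, excursionTerm G R i par t

/-- Split off the first excursion. In `ℝ≥0∞` the product formula needs no convergence. -/
theorem excursionSum_eq (i : V) (par : Option V) :
    excursionSum G R i par =
      1 + (∑ k, edgeTerm G R i par k * excursionSum G R k (some i)) * excursionSum G R i par := by
  conv_lhs => rw [excursionSum, Excursion.tsum_eq]
  simp only [excursionTerm, ENNReal.tsum_mul_left, ENNReal.tsum_mul_right, Finset.sum_mul,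
    mul_assoc]
  rfl

/-- The bound `n` drops in both subtrees, so truncated sums are iterates of the recursion started at
zero. -/
theorem truncatedSum_succ (n : ℕ) (i : V) (par : Option V) :
    ∑' t, truncatedTerm G R (n + 1) i par t =
      1 + (∑ k, edgeTerm G R i par k * ∑' t, truncatedTerm G R n k (some i) t) *
        ∑' t, truncatedTerm G R n i par t := by
  rw [Excursion.tsum_eq]
  simp only [truncatedTerm, ENNReal.tsum_mul_left, ENNReal.tsum_mul_right, Finset.sum_mul,
    mul_assoc]

theorem exists_truncatedTerm_eq (t : Excursion V) (i : V) (par : Option V) :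
    ∃ N, ∀ n, N ≤ n → truncatedTerm G R n i par t = excursionTerm G R i par t := by
  induction t generalizing i par with
  | nil =>
    refine ⟨1, fun n hn => ?_⟩
    obtain ⟨m, rfl⟩ := Nat.exists_eq_add_of_le' hn
    rfl
  | cons k a b iha ihb =>
    obtain ⟨N, hN⟩ := iha k (some i)
    obtain ⟨M, hM⟩ := ihb i par
    refine ⟨max N M + 1, fun n hn => ?_⟩
    obtain ⟨m, rfl⟩ := Nat.exists_eq_add_of_le' (le_trans (Nat.le_add_left 1 _) hn)
    rw [truncatedTerm, hN m (by omega), hM m (by omega), excursionTerm]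

/-- Every tree has finite height, so a finite partial sum is untouched by a high enough truncation.
-/
theorem excursionSum_le_of_truncated {i : V} {par : Option V} {c : ℝ≥0∞}
    (h : ∀ n, ∑' t, truncatedTerm G R n i par t ≤ c) : excursionSum G R i par ≤ c := by
  rw [excursionSum, ENNReal.tsum_eq_iSup_sum]
  refine iSup_le fun s => ?_
  choose N hN using fun t => exists_truncatedTerm_eq G R t i par
  refine le_trans (le_of_eq ?_) ((ENNReal.sum_le_tsum s).trans (h (s.sup N)))
  exact Finset.sum_congr rfl fun t ht => (hN t _ (Finset.le_sup ht)).symm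

theorem excursionTerm_eq_of_valid (hR : R.IsSymm) {t : Excursion V} {i : V} {par : Option V}
    (ht : t.Valid G i par) : excursionTerm G R i par t = ENNReal.ofReal (t.weight R i) := by
  induction t generalizing i par with
  | nil => simp [excursionTerm, Excursion.weight]
  | cons k a b iha ihb =>
    have h0 : 0 ≤ R i k * R k i := by rw [hR.apply i k]; exact mul_self_nonneg _
    rw [excursionTerm, iha ht.2.1, ihb ht.2.2, Excursion.weight, edgeTerm,
      if_pos ((mem_children G).2 ht.1), ENNReal.ofReal_mul (mul_nonneg h0 (a.weight_nonneg hR k)),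
      ENNReal.ofReal_mul h0, mul_assoc]

theorem excursionTerm_eq_zero {t : Excursion V} {i : V} {par : Option V}
    (ht : ¬ t.Valid G i par) : excursionTerm G R i par t = 0 := by
  induction t generalizing i par with
  | nil => exact absurd trivial ht
  | cons k a b iha ihb =>
    rw [excursionTerm]
    by_cases h1 : k ∈ children G i par
    · by_cases h2 : a.Valid G k (some i)
      · rw [ihb fun h3 => ht ⟨(mem_children G).1 h1, h2, h3⟩, mul_zero, mul_zero]
      · rw [iha h2, zero_mul, mul_zero]
    · rw [edgeTerm, if_neg h1, zero_mul]

theorem excursionSum_eq_tsum_valid (hR : R.IsSymm) (i : V) (par : Option V) :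
    excursionSum G R i par =
      ∑' t : {t : Excursion V // t.Valid G i par}, ENNReal.ofReal (t.1.weight R i) := by
  rw [excursionSum, ← tsum_subtype_eq_of_support_subset (s := {t | t.Valid G i par})]
  · exact tsum_congr fun t => excursionTerm_eq_of_valid G R hR t.2
  · exact fun t ht => by_contra fun h => ht (excursionTerm_eq_zero G R h)

theorem excursionSum_le_none (hR : R.IsSymm) (i : V) (par : Option V) :
    excursionSum G R i par ≤ excursionSum G R i none := by
  refine ENNReal.tsum_le_tsum fun t => ?_
  by_cases ht : t.Valid G i par
  · rw [excursionTerm_eq_of_valid G R hR ht, excursionTerm_eq_of_valid G R hR ht.mono]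
  · rw [excursionTerm_eq_zero G R ht]
    exact zero_le

/-- A finite excursion sum is the unconditional sum of the weights of backtracking walks. -/
theorem hasSum_backtracking (hR : R.IsSymm) {i : V} (h : excursionSum G R i none ≠ ⊤) :
    HasSum (fun w : {w : G.Walk i i // IsBacktracking w} => walkWeight R (w : G.Walk i i))
      (excursionSum G R i none).toReal := by
  obtain ⟨e, he⟩ := Excursion.exists_equiv_backtracking G R i
  rw [← e.hasSum_iff]
  have h1 := excursionSum_eq_tsum_valid G R hR i none
  rw [h1] at h ⊢
  have h2 := ENNReal.hasSum_toReal h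
  rw [ENNReal.tsum_toReal_eq fun _ => ENNReal.ofReal_ne_top]
  convert h2 using 1
  funext t
  rw [ENNReal.toReal_ofReal (t.1.weight_nonneg hR i), ← he]
  rfl

theorem excursionSum_ne_top_of_summable (hR : R.IsSymm) {i : V}
    (h : Summable fun w : G.Walk i i => walkWeight R w) : excursionSum G R i none ≠ ⊤ := by
  obtain ⟨e, he⟩ := Excursion.exists_equiv_backtracking G R i
  have h1 := (h.comp_injective (Subtype.val_injective.comp e.injective))
  rw [excursionSum_eq_tsum_valid G R hR]
  have h2 : (fun t : {t : Excursion V // t.Valid G i none} => t.1.weight R i) =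
      (fun w : G.Walk i i => walkWeight R w) ∘ (Subtype.val ∘ e) := by
    funext t; exact (he t).symm
  rw [← h2] at h1
  exact h1.tsum_ofReal_ne_top

end Branching

/-! ### LBP variances as sums over backtracking walks -/

section LBPVariance

variable {V : Type*} [Fintype V] [DecidableEq V] {G : SimpleGraph V} [DecidableRel G.Adj]
  {J R : Matrix V V ℝ} {h : V → ℝ} {m₀ : Messages V}

theorem sum_edgeTerm_mul {i : V} {par : Option V} (hR : R.IsSymm) {f : V → ℝ≥0∞} {g : V → ℝ}
    (hf : ∀ k ∈ children G i par, f k = ENNReal.ofReal (g k))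
    (hg : ∀ k ∈ children G i par, 0 ≤ g k) :
    ∑ k, edgeTerm G R i par k * f k =
      ENNReal.ofReal (∑ k ∈ children G i par, R i k * R k i * g k) := by
  have h0 : ∀ k, 0 ≤ R i k * R k i := fun k => by rw [hR.apply i k]; exact mul_self_nonneg _
  rw [ENNReal.ofReal_sum_of_nonneg fun k hk => mul_nonneg (h0 k) (hg k hk),
    ← Finset.sum_subset (Finset.subset_univ (children G i par)) fun k _ hk => by
      rw [edgeTerm, if_neg hk, zero_mul]]
  refine Finset.sum_congr rfl fun k hk => ?_
  rw [edgeTerm, if_pos hk, hf k hk, ENNReal.ofReal_mul (h0 k)]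

/-- The elimination identity for finite excursion sums. -/
theorem toReal_excursionSum_mul (hR : R.IsSymm) (hfin : ∀ i par, excursionSum G R i par ≠ ⊤)
    (i : V) (par : Option V) :
    0 < (excursionSum G R i par).toReal ∧ (excursionSum G R i par).toReal *
      (1 - ∑ k ∈ children G i par, R i k * R k i * (excursionSum G R k (some i)).toReal) = 1 := by
  have h0 : ∀ k, 0 ≤ R i k * R k i := fun k => by rw [hR.apply i k]; exact mul_self_nonneg _
  have h1 := excursionSum_eq G R i par
  rw [sum_edgeTerm_mul hR (g := fun k => (excursionSum G R k (some i)).toReal)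
    (fun k _ => (ENNReal.ofReal_toReal (hfin k _)).symm) fun k _ => ENNReal.toReal_nonneg] at h1
  set S := ∑ k ∈ children G i par, R i k * R k i * (excursionSum G R k (some i)).toReal with hS
  have hS0 : 0 ≤ S := Finset.sum_nonneg fun k _ => mul_nonneg (h0 k) ENNReal.toReal_nonneg
  have h2 := congrArg ENNReal.toReal h1
  rw [ENNReal.toReal_add ENNReal.one_ne_top (ENNReal.mul_ne_top ENNReal.ofReal_ne_top (hfin i par)),
    ENNReal.toReal_mul, ENNReal.toReal_ofReal hS0, ENNReal.toReal_one] at h2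
  have h3 : 0 ≤ (excursionSum G R i par).toReal := ENNReal.toReal_nonneg
  refine ⟨?_, by linarith⟩
  have := mul_nonneg hS0 h3
  linarith

/-- LBP precisions started from nonnegative messages dominate the inverse excursion sums. -/
theorem LBPConverges.inv_excursionSum_le (hc : LBPConverges G J h m₀) (hR : R.IsSymm)
    (hRJ : ∀ i k, G.Adj i k → J i k * J k i = R i k * R k i) (hdiag : ∀ i, J i i = 1)
    (h₀ : ∀ i j, G.Adj i j → 0 ≤ m₀.J i j) (hfin : ∀ i par, excursionSum G R i par ≠ ⊤)
    (i : V) (par : Option V) :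
    ((excursionSum G R i par).toReal)⁻¹ ≤ precision G J (lbpLimit G J h m₀) i par := by
  set w := fun i par => (excursionSum G R i par).toReal with hw
  have hq : ∀ i k, 0 ≤ R i k * R k i := fun i k => by rw [hR.apply i k]; exact mul_self_nonneg _
  have prec_le : ∀ (m : Messages V) (i : V) (par : Option V),
      (∀ k, G.Adj i k → -(R i k * R k i * w k (some i)) ≤ m.J k i) →
      (w i par)⁻¹ ≤ precision G J m i par := fun m i par hm => by
    obtain ⟨hpos, heq⟩ := toReal_excursionSum_mul hR hfin i par
    have h1 : (w i par)⁻¹ = 1 - ∑ k ∈ children G i par, R i k * R k i * w k (some i) :=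
      inv_eq_of_mul_eq_one_right heq
    rw [h1, precision, hdiag, sub_eq_add_neg, ← Finset.sum_neg_distrib]
    gcongr with k hk
    exact hm k ((mem_children G).1 hk).1
  -- The invariant holds at the start because its left side is nonpositive, which is where
  -- nonnegative initial messages enter. An update preserves it since inversion reverses order on
  -- positive numbers.
  have bound : ∀ t : ℕ, ∀ k i, G.Adj i k →
      -(R i k * R k i * w k (some i)) ≤ (lbpIter G J h m₀ t).J k i := fun t => by
    induction t with
    | zero =>
      intro k i hik
      exact le_trans (neg_nonpos.2 (mul_nonneg (hq i k) ENNReal.toReal_nonneg)) (h₀ k i hik.symm)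
    | succ t ih =>
      intro k i hik
      have h1 := prec_le _ k (some i) fun l hl => ih l k hl
      have hpos := (toReal_excursionSum_mul hR hfin k (some i)).1
      rw [precision_some] at h1
      have h2 := inv_le_of_inv_le₀ hpos h1
      have e : (lbpIter G J h m₀ (t + 1)).J k i =
          -(J i k * (cavityPrecision G J (lbpIter G J h m₀ t) k i)⁻¹ * J k i) := by
        rw [lbpIter_succ]; rfl
      rw [e, mul_right_comm (J i k), hRJ i k hik]
      exact neg_le_neg (mul_le_mul_of_nonneg_left h2 (hq i k))
  exact prec_le _ i par fun k hik =>
    ge_of_tendsto' (hc.tendsto_lbpLimit hik.symm).1 fun t => bound t k i hik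

/-- Positive fixed-point precisions bound the excursion sums. -/
theorem LBPConverges.excursionSum_le (hc : LBPConverges G J h m₀) (hR : R.IsSymm)
    (hRJ : ∀ i k, G.Adj i k → J i k * J k i = R i k * R k i) (hdiag : ∀ i, J i i = 1)
    (hp : LBPProper G J h m₀) (i : V) :
    excursionSum G R i none ≤ ENNReal.ofReal (lbpVar G J h m₀ i) := by
  set m := lbpLimit G J h m₀ with hm
  have hpos : ∀ (i : V) (par : Option V), (∀ j, par = some j → G.Adj i j) →
      0 < precision G J m i par := fun i par hpar => by
    cases par with
    | none => rw [precision_none]; exact hp.2 i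
    | some j => rw [precision_some]; exact hp.1 i j (hpar j rfl)
  have hq : ∀ i k, 0 ≤ R i k * R k i := fun i k => by rw [hR.apply i k]; exact mul_self_nonneg _
  -- The positive inverse precisions solve the recursion and dominate the zero start; the recursion
  -- is monotone, so they dominate every truncation. Parents are restricted to neighbours, where
  -- positivity and the fixed-point equations are known.
  have bound : ∀ (n : ℕ) (i : V) (par : Option V), (∀ j, par = some j → G.Adj i j) →
      ∑' t, truncatedTerm G R n i par t ≤ ENNReal.ofReal (precision G J m i par)⁻¹ := fun n => by
    induction n with
    | zero => intro i par _; simp [truncatedTerm]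
    | succ n ih =>
      intro i par hpar
      have hi := hpos i par hpar
      have hk : ∀ k ∈ children G i par, 0 < precision G J m k (some i) := fun k hk =>
        hpos k _ fun j hj => by
          obtain rfl := Option.some.inj hj
          exact ((mem_children G).1 hk).1.symm
      have h1 : precision G J m i par =
          1 - ∑ k ∈ children G i par, R i k * R k i * (precision G J m k (some i))⁻¹ := by
        rw [precision, hdiag, sub_eq_add_neg, ← Finset.sum_neg_distrib]
        congr 1
        refine Finset.sum_congr rfl fun k hk => ?_
        have hik := ((mem_children G).1 hk).1
        rw [hc.isFixedPoint.J_eq k i hik.symm, precision_some, ← hRJ i k hik, mul_right_comm]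
      have h2 : (precision G J m i par)⁻¹ = 1 + (∑ k ∈ children G i par,
          R i k * R k i * (precision G J m k (some i))⁻¹) * (precision G J m i par)⁻¹ := by
        have := mul_inv_cancel₀ hi.ne'
        nth_rewrite 1 [h1] at this
        linarith
      have hS : 0 ≤ ∑ k ∈ children G i par, R i k * R k i * (precision G J m k (some i))⁻¹ :=
        Finset.sum_nonneg fun k hk' => mul_nonneg (hq i k) (inv_nonneg.2 (hk k hk').le)
      rw [truncatedSum_succ, h2, ENNReal.ofReal_add zero_le_one
          (mul_nonneg hS (inv_nonneg.2 hi.le)), ENNReal.ofReal_one, ENNReal.ofReal_mul hS,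
        ← sum_edgeTerm_mul hR (f := fun k => ENNReal.ofReal (precision G J m k (some i))⁻¹)
          (fun _ _ => rfl) fun k hk' => inv_nonneg.2 (hk k hk').le]
      refine add_le_add le_rfl (mul_le_mul' (Finset.sum_le_sum fun k _ => ?_) (ih i par hpar))
      by_cases hk' : k ∈ children G i par
      · refine mul_le_mul' le_rfl (ih k (some i) fun j hj => ?_)
        obtain rfl := Option.some.inj hj
        exact ((mem_children G).1 hk').1.symm
      · simp [edgeTerm, hk']
  rw [lbpVar, ← precision_none]
  exact excursionSum_le_of_truncated G R fun n => bound n i none (by simp)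

/-- The variances computed by LBP are the sums of the weights of all backtracking walks. -/
theorem LBPConverges.hasSum_lbpVar (hc : LBPConverges G J h m₀) (hR : R.IsSymm)
    (hRJ : ∀ i k, G.Adj i k → J i k * J k i = R i k * R k i) (hdiag : ∀ i, J i i = 1)
    (h₀ : ∀ i j, G.Adj i j → 0 ≤ m₀.J i j)
    (hp : LBPProper G J h m₀ ∨ WalkSummable G R) (i : V) :
    HasSum (fun w : {w : G.Walk i i // IsBacktracking w} => walkWeight R (w : G.Walk i i))
      (lbpVar G J h m₀ i) := by
  have hfin : ∀ i par, excursionSum G R i par ≠ ⊤ := fun i par => by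
    refine ne_top_of_le_ne_top ?_ (excursionSum_le_none G R hR i par)
    rcases hp with hp | hp
    · exact ne_top_of_le_ne_top ENNReal.ofReal_ne_top (hc.excursionSum_le hR hRJ hdiag hp i)
    · exact excursionSum_ne_top_of_summable G R hR (hp i i)
  have hle := hc.inv_excursionSum_le hR hRJ hdiag h₀ hfin
  have hpos : ∀ i par, 0 < precision G J (lbpLimit G J h m₀) i par := fun i par =>
    lt_of_lt_of_le (inv_pos.2 (toReal_excursionSum_mul hR hfin i par).1) (hle i par)
  -- Finiteness of the excursion sums makes the precisions positive, so the walk-summable case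
  -- reduces to the proper one.
  have hproper : LBPProper G J h m₀ :=
    ⟨fun i j _ => precision_some G J _ i j ▸ hpos i (some j),
      fun i => precision_none G J _ i ▸ hpos i none⟩
  have h1 : lbpVar G J h m₀ i = (excursionSum G R i none).toReal := by
    have hv : lbpVar G J h m₀ i = (precision G J (lbpLimit G J h m₀) i none)⁻¹ := by
      rw [precision_none, lbpVar]
    refine le_antisymm ?_ ?_
    · rw [hv]
      exact inv_le_of_inv_le₀ (toReal_excursionSum_mul hR hfin i none).1 (hle i none)
    · refine ENNReal.toReal_le_of_le_ofReal ?_ (hc.excursionSum_le hR hRJ hdiag hproper i)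
      rw [hv]
      exact (inv_pos.2 (hpos i none)).le
  rw [h1]
  exact hasSum_backtracking G R hR (hfin i none)

end LBPVariance

/-! ### Linear functionals of Neumann series -/

section MatrixSeries

variable {m : Type*} [Fintype m] [DecidableEq m]

/-- Divide the characteristic polynomial by `X - 1`: the remainder is its value `det (1 - A)` at
one, and Cayley–Hamilton kills the polynomial at `A`. -/
theorem exists_inv_eq_aeval {A : Matrix m m ℝ} (hA : IsUnit (1 - A).det) :
    ∃ p : Polynomial ℝ, (1 - A)⁻¹ = Polynomial.aeval A p := by
  have hdet : A.charpoly.eval 1 = (1 - A).det := by rw [Matrix.eval_charpoly, map_one]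
  have h1 := Polynomial.X_sub_C_mul_divByMonic_eq_sub_modByMonic A.charpoly 1
  rw [Polynomial.modByMonic_X_sub_C_eq_C_eval, hdet] at h1
  have h2 := congrArg (Polynomial.aeval A) h1
  rw [map_mul, map_sub, map_sub, Matrix.aeval_self_charpoly, Polynomial.aeval_X,
    Polynomial.aeval_C, Polynomial.aeval_C, map_one, zero_sub] at h2
  refine ⟨Polynomial.C (1 - A).det⁻¹ * (A.charpoly /ₘ (Polynomial.X - Polynomial.C 1)),
    Matrix.inv_eq_right_inv ?_⟩
  have h3 : ∀ X : Matrix m m ℝ, (1 - A) * X = -((A - 1) * X) := fun X => by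
    rw [← neg_mul, neg_sub]
  rw [map_mul, Polynomial.aeval_C, ← mul_assoc, ← Algebra.commutes, mul_assoc, h3, h2, neg_neg,
    ← map_mul, inv_mul_cancel₀ hA.ne_zero, map_one]

theorem sum_pow_eq {A : Matrix m m ℝ} (hA : IsUnit (1 - A).det) (N : ℕ) :
    ∑ n ∈ Finset.range N, A ^ n = (1 - A)⁻¹ - A ^ N * (1 - A)⁻¹ := by
  rw [← one_sub_mul, ← geom_sum_mul_neg A N, Matrix.mul_nonsing_inv_cancel_right _ _ hA]

/-- If a linear functional of the Neumann series of `A` converges, its sum is the functional of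
`(1 - A)⁻¹`, even if the Neumann series itself diverges. -/
theorem eq_of_tendsto_sum_pow {A : Matrix m m ℝ} (hA : IsUnit (1 - A).det)
    (L : Matrix m m ℝ →ₗ[ℝ] ℝ) {s : ℝ}
    (h : Filter.Tendsto (fun N : ℕ => ∑ n ∈ Finset.range N, L (A ^ n)) Filter.atTop (𝓝 s)) :
    s = L (1 - A)⁻¹ := by
  have hc : Filter.Tendsto (fun n : ℕ => L (A ^ n)) Filter.atTop (𝓝 0) := by
    have h1 := ((Filter.tendsto_add_atTop_iff_nat 1).2 h).sub h
    simpa [Finset.sum_range_succ] using h1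
  obtain ⟨p, hp⟩ := exists_inv_eq_aeval hA
  -- The remainder of the partial sums is a fixed finite combination of shifted terms `L (A ^ (N +
  -- k))`, each tending to zero because the series converges.
  have hzero : Filter.Tendsto (fun N : ℕ => L (A ^ N * (1 - A)⁻¹)) Filter.atTop (𝓝 0) := by
    have h1 : ∀ N : ℕ, L (A ^ N * (1 - A)⁻¹) =
        ∑ k ∈ Finset.range (p.natDegree + 1), p.coeff k * L (A ^ (N + k)) := fun N => by
      rw [hp, Polynomial.aeval_eq_sum_range, Finset.mul_sum, map_sum]
      simp only [mul_smul_comm, map_smul, ← pow_add, smul_eq_mul]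
    simp only [h1]
    rw [show (0 : ℝ) = ∑ k ∈ Finset.range (p.natDegree + 1), p.coeff k * 0 by simp]
    exact tendsto_finsetSum _ fun k _ =>
      ((Filter.tendsto_add_atTop_iff_nat k).2 hc).const_mul _
  simp only [← map_sum, sum_pow_eq hA, map_sub] at h
  refine tendsto_nhds_unique h ?_
  simpa using tendsto_const_nhds.sub hzero

theorem tendsto_sum_pow {A : Matrix m m ℝ} (hA : IsUnit (1 - A).det)
    (hA' : Filter.Tendsto (fun N : ℕ => A ^ N) Filter.atTop (𝓝 0)) :
    Filter.Tendsto (fun N : ℕ => ∑ n ∈ Finset.range N, A ^ n) Filter.atTop (𝓝 (1 - A)⁻¹) := by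
  simp only [sum_pow_eq hA]
  simpa using tendsto_const_nhds.sub (hA'.mul_const (1 - A)⁻¹)

/-- The powers of a symmetric matrix tend to zero if its eigenvalues lie in `(-1, 1)`. -/
theorem tendsto_pow_zero {A : Matrix m m ℝ} (h₁ : (1 - A).PosDef) (h₂ : (1 + A).PosDef) :
    Filter.Tendsto (fun N : ℕ => A ^ N) Filter.atTop (𝓝 0) := by
  have hA : A.IsHermitian := by
    have := h₂.1.sub (Matrix.isHermitian_one (n := m) (α := ℝ))
    simpa using this
  have habs : ∀ i, |hA.eigenvalues i| < 1 := fun i => by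
    set v : m → ℝ := ⇑(hA.eigenvectorBasis i) with hv
    have hv0 : v ≠ 0 := by
      intro h0
      have := hA.eigenvectorBasis.orthonormal.ne_zero i
      exact this (by ext j; exact congrFun h0 j)
    have e : A *ᵥ v = hA.eigenvalues i • v := hA.mulVec_eigenvectorBasis i
    have hvv : 0 < v ⬝ᵥ v := by
      have := Matrix.dotProduct_star_self_pos_iff.2 hv0
      simpa using this
    -- The two quadratic forms at an eigenvector with eigenvalue `λ` are `1 - λ` and `1 + λ` times
    -- its squared norm.
    have g1 := h₁.dotProduct_mulVec_pos hv0
    have g2 := h₂.dotProduct_mulVec_pos hv0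
    simp only [star_trivial, Matrix.sub_mulVec, Matrix.add_mulVec, Matrix.one_mulVec, e,
      dotProduct_sub, dotProduct_add, dotProduct_smul, smul_eq_mul] at g1 g2
    rw [abs_lt]
    constructor <;> nlinarith
  have hpow : ∀ N : ℕ, A ^ N = Unitary.conjStarAlgAut ℝ _ hA.eigenvectorUnitary
      (Matrix.diagonal fun i => hA.eigenvalues i ^ N) := fun N => by
    conv_lhs => rw [hA.spectral_theorem]
    rw [← map_pow, Matrix.diagonal_pow]
    rfl
  simp only [hpow, Unitary.conjStarAlgAut_apply]
  have hd : Filter.Tendsto (fun N : ℕ => Matrix.diagonal fun i => hA.eigenvalues i ^ N)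
      Filter.atTop (𝓝 (0 : Matrix m m ℝ)) := by
    have h0 : Filter.Tendsto (fun (N : ℕ) (i : m) => hA.eigenvalues i ^ N) Filter.atTop (𝓝 0) :=
      tendsto_pi_nhds.2 fun i => tendsto_pow_atTop_nhds_zero_of_abs_lt_one (habs i)
    have := (Continuous.matrix_diagonal (continuous_id (X := m → ℝ))).tendsto 0
    simp only [id, Matrix.diagonal_zero'] at this
    exact this.comp h0
  simpa using (hd.const_mul _).mul_const _

/-- The spectral radius only has to keep eigenvalues above `-1`: for `A = 1 - J` the bound below `1`
is positive definiteness of `J`. -/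
theorem posDef_one_add_of_spectralRadius_lt {A : Matrix m m ℝ} (hA : A.IsHermitian)
    (h : spectralRadius ℝ A < 1) : (1 + A).PosDef := by
  have hH : (1 + A).IsHermitian := Matrix.isHermitian_one.add hA
  refine hH.posDef_iff_eigenvalues_pos.2 fun i => ?_
  have h1 := hH.eigenvalues_mem_spectrum_real i
  have h2 : hH.eigenvalues i - 1 ∈ spectrum ℝ A := by
    rw [spectrum.mem_iff] at h1 ⊢
    convert h1 using 2
    rw [map_sub, map_one]
    abel
  have h3 : (‖hH.eigenvalues i - 1‖₊ : ENNReal) < 1 :=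
    lt_of_le_of_lt (le_iSup₂ (f := fun k (_ : k ∈ spectrum ℝ A) => (‖k‖₊ : ENNReal)) _ h2) h
  have h4 : ‖hH.eigenvalues i - 1‖ < 1 := by exact_mod_cast h3
  rw [Real.norm_eq_abs, abs_lt] at h4
  linarith [h4.1]

end MatrixSeries

/-! ### Walk-sums by length as matrix powers -/

section WalkPowers

variable {V : Type*} [Fintype V] [DecidableEq V] {G : SimpleGraph V} [DecidableRel G.Adj]
  {R : Matrix V V ℝ}

theorem finsetWalkLength_succ (n : ℕ) (i j : V) :
    G.finsetWalkLength (n + 1) i j = Finset.univ.biUnion fun k : G.neighborSet i =>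
      (G.finsetWalkLength n (k : V) j).image
        (SimpleGraph.Walk.cons ((G.mem_neighborSet i k).1 k.2)) := by
  ext w
  simp only [SimpleGraph.mem_finsetWalkLength_iff, Finset.mem_biUnion, Finset.mem_univ, true_and,
    Finset.mem_image]
  constructor
  · intro h
    cases w with
    | nil => simp at h
    | @cons _ k _ hk w => exact ⟨⟨k, hk⟩, w, by simpa using h, rfl⟩
  · rintro ⟨k, w, hw, rfl⟩
    simpa using hw

theorem sum_walkWeight_length (hR : ∀ i j, ¬ G.Adj i j → R i j = 0) (n : ℕ) (i j : V) :
    ∑ w ∈ G.finsetWalkLength n i j, walkWeight R w = (R ^ n) i j := by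
  induction n generalizing i with
  | zero =>
    rw [SimpleGraph.finsetWalkLength, pow_zero, Matrix.one_apply]
    split_ifs with h
    · subst h
      simp [walkWeight]
    · rfl
  | succ n ih =>
    rw [finsetWalkLength_succ, pow_succ', Matrix.mul_apply, Finset.sum_biUnion]
    · have h1 : ∀ k : G.neighborSet i,
          ∑ w ∈ (G.finsetWalkLength n (k : V) j).image
              (SimpleGraph.Walk.cons ((G.mem_neighborSet i k).1 k.2)),
            walkWeight R w = R i k * (R ^ n) k j := fun k => by
        rw [Finset.sum_image fun w _ w' _ h => by simpa using h, ← ih, Finset.mul_sum]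
        exact Finset.sum_congr rfl fun w _ => walkWeight_cons R _ w
      rw [Finset.sum_congr rfl fun k _ => h1 k,
        ← Finset.sum_subset (Finset.subset_univ (G.neighborFinset i)) fun k _ hk => by
          rw [hR i k (by simpa using hk), zero_mul]]
      exact (Finset.sum_subtype _ (fun x => by simp) fun k => R i k * (R ^ n) k j).symm
    · intro x _ y _ hxy
      rw [Function.onFun, Finset.disjoint_left]
      intro w hw hw'
      obtain ⟨u, _, rfl⟩ := Finset.mem_image.1 hw
      obtain ⟨u', _, h⟩ := Finset.mem_image.1 hw'
      simp only [SimpleGraph.Walk.cons.injEq] at h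
      exact hxy (Subtype.ext h.1.symm)

theorem sum_walkWeight_lengthLT (hR : ∀ i j, ¬ G.Adj i j → R i j = 0) (N : ℕ) (i j : V) :
    ∑ w ∈ G.finsetWalkLengthLT N i j, walkWeight R w = ∑ n ∈ Finset.range N, (R ^ n) i j := by
  have h1 : G.finsetWalkLengthLT N i j =
      (Finset.range N).biUnion fun n => G.finsetWalkLength n i j := by
    ext w
    rw [SimpleGraph.mem_finsetWalkLengthLT_iff, Finset.mem_biUnion]
    simp only [SimpleGraph.mem_finsetWalkLength_iff, Finset.mem_range, exists_eq_right']
  rw [h1, Finset.sum_biUnion fun n _ k _ hnk => Finset.disjoint_left.2 fun w hw hw' => hnk <| by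
    rw [SimpleGraph.mem_finsetWalkLength_iff] at hw hw'
    exact hw.symm.trans hw']
  exact Finset.sum_congr rfl fun n _ => sum_walkWeight_length hR n i j

/-- Unconditional convergence implies convergence of the sums ordered by walk-length. -/
theorem hasWalkSum_of_hasSum {i j : V} {W : Set (G.Walk i j)} {s : ℝ}
    (h : HasSum (fun w : W => walkWeight R (w : G.Walk i j)) s) : HasWalkSum R W s := by
  have h1 : Filter.Tendsto (fun t : Finset (G.Walk i j) => ∑ w ∈ t, W.indicator (walkWeight R) w)
      Filter.atTop (𝓝 s) := by
    have h0 : HasSum (W.indicator (walkWeight R)) s := hasSum_subtype_iff_indicator.1 h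
    rwa [HasSum, SummationFilter.unconditional_filter] at h0
  -- The finite sets of walks of length below `N` exhaust all walks, so ordered sums are a subnet of
  -- the unconditional ones.
  have h2 : Filter.Tendsto (fun N => G.finsetWalkLengthLT N i j) Filter.atTop Filter.atTop := by
    refine Filter.tendsto_atTop_finset_of_monotone (fun a b hab w hw => ?_)
      fun w => ⟨w.length + 1, ?_⟩
    · rw [SimpleGraph.mem_finsetWalkLengthLT_iff] at hw ⊢
      omega
    · rw [SimpleGraph.mem_finsetWalkLengthLT_iff]
      omega
  exact h1.comp h2

end WalkPowers

/-! ### Walks avoiding the feedback nodes -/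

section Restriction

variable {V : Type*} {G : SimpleGraph V} {F : Finset V}

/-- The inclusion of the remaining graph. -/
def restHom (G : SimpleGraph V) (F : Finset V) : restGraph G F →g G where
  toFun := Subtype.val
  map_rel' h := h

/-- A walk of the remaining graph as a walk of the whole graph. -/
def liftWalk {i j : Rest F} (w : (restGraph G F).Walk i j) : G.Walk (i : V) j :=
  w.map (restHom G F)

theorem liftWalk_cons {i j k : Rest F} (h : (restGraph G F).Adj i j)
    (w : (restGraph G F).Walk j k) :
    liftWalk (.cons h w) = .cons (show G.Adj i j from h) (liftWalk w) := rfl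

theorem liftWalk_injective {i j : Rest F} :
    Function.Injective (liftWalk : (restGraph G F).Walk i j → G.Walk (i : V) j) :=
  SimpleGraph.Walk.map_injective_of_injective (f := restHom G F) Subtype.val_injective _ _

theorem length_liftWalk {i j : Rest F} (w : (restGraph G F).Walk i j) :
    (liftWalk w).length = w.length :=
  SimpleGraph.Walk.length_map _ _

theorem support_liftWalk {i j : Rest F} (w : (restGraph G F).Walk i j) :
    (liftWalk w).support = w.support.map Subtype.val :=
  SimpleGraph.Walk.support_map _ _

theorem walkWeight_liftWalk (J : Matrix V V ℝ) [DecidableEq V] {i j : Rest F}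
    (w : (restGraph G F).Walk i j) :
    walkWeight (1 - J) (liftWalk w) = walkWeight (1 - restJ J F) w := by
  induction w with
  | nil => rfl
  | cons h w ih =>
    rw [liftWalk_cons, walkWeight_cons, walkWeight_cons, ih]
    simp [Matrix.one_apply, Subtype.ext_iff]

theorem BacktrackStep.map {α β : Type*} (f : α → β) {l l' : List α} (h : BacktrackStep l l') :
    BacktrackStep (l.map f) (l'.map f) := by
  obtain ⟨l₁, l₂, a, b, rfl, rfl⟩ := h
  exact ⟨l₁.map f, l₂.map f, f a, f b, by simp, by simp⟩

theorem BacktrackStep.exists_of_map {α β : Type*} {f : α → β} (hf : Function.Injective f)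
    {l : List α} {l' : List β} (h : BacktrackStep (l.map f) l') :
    ∃ k, BacktrackStep l k ∧ k.map f = l' := by
  obtain ⟨l₁, l₂, a, b, hl, rfl⟩ := h
  obtain ⟨m₁, m₂, rfl, rfl, h2⟩ := List.map_eq_append_iff.1 hl
  obtain ⟨x, m₃, rfl, rfl, h3⟩ := List.map_eq_cons_iff.1 h2
  obtain ⟨y, m₄, rfl, rfl, h4⟩ := List.map_eq_cons_iff.1 h3
  obtain ⟨z, m₅, rfl, hz, rfl⟩ := List.map_eq_cons_iff.1 h4
  obtain rfl := hf hz
  exact ⟨m₁ ++ z :: m₅, ⟨m₁, m₅, z, y, rfl, rfl⟩, by simp⟩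

/-- Reductions only delete vertices, so they never leave the image of the inclusion and lift back
along it. -/
theorem isBacktracking_map_iff {i : Rest F} (w : (restGraph G F).Walk i i) :
    IsBacktracking (liftWalk w) ↔ IsBacktracking w := by
  unfold IsBacktracking
  rw [support_liftWalk]
  constructor
  · intro h
    have key : ∀ l l' : List V, Relation.ReflTransGen BacktrackStep l l' →
        ∀ k : List (Rest F), k.map Subtype.val = l →
          ∃ k', Relation.ReflTransGen BacktrackStep k k' ∧ k'.map Subtype.val = l' := by
      intro l l' h
      induction h with
      | refl => exact fun k hk => ⟨k, .refl, hk⟩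
      | tail _ hstep ih =>
        intro k hk
        obtain ⟨k', hk', rfl⟩ := ih k hk
        obtain ⟨k'', h1, h2⟩ := hstep.exists_of_map Subtype.val_injective
        exact ⟨k'', hk'.tail h1, h2⟩
    obtain ⟨k', h1, h2⟩ := key _ _ h _ rfl
    have : k' = [i] := List.map_injective_iff.2 Subtype.val_injective h2
    exact this ▸ h1
  · exact fun h => Relation.ReflTransGen.lift (List.map Subtype.val) (fun _ _ h => h.map _) _ _ h

/-- The walks that avoid `F` are the walks of the remaining graph. -/
def restWalkEquiv (G : SimpleGraph V) (F : Finset V) (i j : Rest F) :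
    (restGraph G F).Walk i j ≃ {w : G.Walk (i : V) j // ∀ v ∈ w.support, v ∉ F} :=
  Equiv.ofBijective (fun w => ⟨liftWalk w, fun v hv => by
    obtain ⟨x, _, rfl⟩ := List.mem_map.1 (support_liftWalk w ▸ hv)
    exact x.2⟩)
  ⟨fun w w' h => liftWalk_injective (Subtype.mk.inj h),
    fun w => ⟨w.1.induce {v | v ∉ F} w.2, Subtype.ext (w.1.map_induce w.2)⟩⟩

theorem hasSum_backtrackingWalks [DecidableEq V] {J : Matrix V V ℝ} {i : Rest F} {b : ℝ}
    (h : HasSum (fun w : {w : (restGraph G F).Walk i i // IsBacktracking w} =>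
      walkWeight (1 - restJ J F) (w : (restGraph G F).Walk i i)) b) :
    HasSum (fun w : backtrackingWalks G F (i : V) => walkWeight (1 - J) (w : G.Walk (i : V) i))
      b := by
  let e : {w : (restGraph G F).Walk i i // IsBacktracking w} ≃ backtrackingWalks G F (i : V) :=
    ((restWalkEquiv G F i i).subtypeEquiv (q := fun w => IsBacktracking w.1)
      fun w => (isBacktracking_map_iff w).symm).trans
      (Equiv.subtypeSubtypeEquivSubtypeInter _ _)
  rw [← e.hasSum_iff]
  convert h using 1
  funext w
  exact walkWeight_liftWalk J w.1

theorem sum_indicator_avoiding [Fintype V] [DecidableEq V] [DecidableRel G.Adj] (J : Matrix V V ℝ)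
    (i j : Rest F) (N : ℕ) :
    ∑ w ∈ G.finsetWalkLengthLT N (i : V) j,
      {w : G.Walk (i : V) j | ∀ v ∈ w.support, v ∉ F}.indicator (walkWeight (1 - J)) w =
    ∑ w ∈ (restGraph G F).finsetWalkLengthLT N i j, walkWeight (1 - restJ J F) w := by
  classical
  rw [Finset.sum_indicator_eq_sum_filter]
  symm
  refine Finset.sum_bij (fun w _ => liftWalk w) (fun w hw => ?_) (fun w _ w' _ h => ?_)
    (fun w hw => ?_) fun w _ => (walkWeight_liftWalk J w).symm
  · rw [SimpleGraph.mem_finsetWalkLengthLT_iff] at hw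
    refine Finset.mem_filter.2 ⟨?_, (restWalkEquiv G F i j w).2⟩
    rw [SimpleGraph.mem_finsetWalkLengthLT_iff, length_liftWalk]
    exact hw
  · exact (restWalkEquiv G F i j).injective (Subtype.ext h)
  · obtain ⟨h1, h2⟩ := Finset.mem_filter.1 hw
    obtain ⟨v, hv⟩ := (restWalkEquiv G F i j).surjective ⟨w, h2⟩
    have hv' : liftWalk v = w := congrArg Subtype.val hv
    refine ⟨v, ?_, hv'⟩
    rw [SimpleGraph.mem_finsetWalkLengthLT_iff] at h1 ⊢
    rw [← hv', length_liftWalk] at h1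
    exact h1

end Restriction

/-! ### Values and convergence of the walk-sums -/

section WalkSums

variable {V : Type*} [Fintype V] [DecidableEq V] {G : SimpleGraph V} [DecidableRel G.Adj]
  {J : Matrix V V ℝ} {F : Finset V}

omit [Fintype V] [DecidableRel G.Adj] in
theorem one_sub_apply_eq_zero (hdiag : ∀ i, J i i = 1)
    (hG : ∀ i j, i ≠ j → (J i j ≠ 0 ↔ G.Adj i j)) (i j : V) (hij : ¬ G.Adj i j) :
    (1 - J) i j = 0 := by
  by_cases h : i = j
  · subst h
    simp [hdiag]
  · have : J i j = 0 := by_contra fun h0 => hij ((hG i j h).1 h0)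
    simp [h, this]

theorem isUnit_det_of_posDef (hJ : J.PosDef) : IsUnit J.det :=
  (Matrix.isUnit_iff_isUnit_det _).1 hJ.isUnit

theorem sum_indicator_avoiding_eq (hdiag : ∀ i, J i i = 1)
    (hG : ∀ i j, i ≠ j → (J i j ≠ 0 ↔ G.Adj i j)) (i : Rest F) (N : ℕ) :
    ∑ w ∈ G.finsetWalkLengthLT N (i : V) i,
      {w : G.Walk (i : V) i | ∀ v ∈ w.support, v ∉ F}.indicator (walkWeight (1 - J)) w =
    ∑ n ∈ Finset.range N, ((1 - restJ J F) ^ n) i i := by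
  rw [sum_indicator_avoiding, sum_walkWeight_lengthLT]
  exact one_sub_apply_eq_zero (fun j => hdiag j) (restGraph_adj_iff G hG)

theorem sum_indicator_visiting (hdiag : ∀ i, J i i = 1)
    (hG : ∀ i j, i ≠ j → (J i j ≠ 0 ↔ G.Adj i j)) (i : Rest F) (N : ℕ) :
    ∑ w ∈ G.finsetWalkLengthLT N (i : V) i, (visitingWalks G F i).indicator (walkWeight (1 - J)) w =
      ∑ n ∈ Finset.range N, (((1 - J) ^ n) i i - ((1 - restJ J F) ^ n) i i) := by
  have h1 : visitingWalks G F (i : V) = {w : G.Walk (i : V) i | ∀ v ∈ w.support, v ∉ F}ᶜ := by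
    ext w
    simp [visitingWalks]
  rw [Finset.sum_sub_distrib, ← sum_indicator_avoiding_eq hdiag hG,
    ← sum_walkWeight_lengthLT (one_sub_apply_eq_zero hdiag hG), h1, Set.indicator_compl,
    ← Finset.sum_sub_distrib]
  rfl

theorem sum_indicator_nonBacktracking (hdiag : ∀ i, J i i = 1)
    (hG : ∀ i j, i ≠ j → (J i j ≠ 0 ↔ G.Adj i j)) (i : Rest F) (N : ℕ) :
    ∑ w ∈ G.finsetWalkLengthLT N (i : V) i,
      (nonBacktrackingWalks G F i).indicator (walkWeight (1 - J)) w +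
    ∑ w ∈ G.finsetWalkLengthLT N (i : V) i,
      (backtrackingWalks G F i).indicator (walkWeight (1 - J)) w =
    ∑ n ∈ Finset.range N, ((1 - restJ J F) ^ n) i i := by
  have h1 : {w : G.Walk (i : V) i | ∀ v ∈ w.support, v ∉ F} =
      nonBacktrackingWalks G F i ∪ backtrackingWalks G F i := by
    ext w
    simp only [nonBacktrackingWalks, backtrackingWalks, Set.mem_union, Set.mem_ofPred_eq]
    tauto
  have h2 : Disjoint (nonBacktrackingWalks G F (i : V)) (backtrackingWalks G F i) :=
    Set.disjoint_left.2 fun w hw hw' => hw.2 hw'.2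
  rw [← sum_indicator_avoiding_eq hdiag hG, h1, Set.indicator_union_of_disjoint h2,
    ← Finset.sum_add_distrib]

/-- If the ordered sum over the visiting walks converges, it converges to the reduction of the
variance by elimination. -/
theorem HasWalkSum.visiting_eq (hJ : J.PosDef) (hdiag : ∀ i, J i i = 1)
    (hG : ∀ i j, i ≠ j → (J i j ≠ 0 ↔ G.Adj i j)) {i : Rest F} {s : ℝ}
    (h : HasWalkSum (1 - J) (visitingWalks G F i) s) :
    s = J⁻¹ i i - (restJ J F)⁻¹ i i := by
  have hu := isUnit_det_of_posDef hJ
  have hu' := isUnit_det_of_posDef (restJ_posDef hJ F)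
  -- The full and restricted Neumann series may diverge separately. Placing both in one
  -- block-diagonal matrix makes the difference of entries a single linear functional, to which
  -- `eq_of_tendsto_sum_pow` applies.
  set A : Matrix (V ⊕ Rest F) (V ⊕ Rest F) ℝ := Matrix.fromBlocks (1 - J) 0 0 (1 - restJ J F)
    with hA
  have h1 : 1 - A = Matrix.fromBlocks J 0 0 (restJ J F) := by
    rw [hA, ← Matrix.fromBlocks_one, sub_eq_add_neg, Matrix.fromBlocks_neg, Matrix.fromBlocks_add]
    simp
  have h2 : IsUnit (1 - A).det := by
    rw [h1, Matrix.det_fromBlocks_zero₂₁]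
    exact hu.mul hu'
  have h3 : (1 - A)⁻¹ = Matrix.fromBlocks J⁻¹ 0 0 (restJ J F)⁻¹ := by
    refine Matrix.inv_eq_right_inv ?_
    rw [h1, Matrix.fromBlocks_multiply, ← Matrix.fromBlocks_one]
    simp [Matrix.mul_nonsing_inv _ hu, Matrix.mul_nonsing_inv _ hu']
  have h4 := eq_of_tendsto_sum_pow h2
    (Matrix.entryLinearMap ℝ ℝ (Sum.inl (i : V)) (Sum.inl (i : V)) -
      Matrix.entryLinearMap ℝ ℝ (Sum.inr i) (Sum.inr i)) (s := s) (by
    simp only [hA, Matrix.fromBlocks_diagonal_pow, LinearMap.sub_apply,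
      Matrix.entryLinearMap_apply, Matrix.fromBlocks_apply₁₁, Matrix.fromBlocks_apply₂₂]
    simpa only [HasWalkSum, sum_indicator_visiting hdiag hG] using h)
  rw [h4, h3]
  rfl

/-- The two classes partition the self-return walks avoiding `F`, so their ordered sums add up to a
diagonal entry of the restricted Neumann series. -/
theorem HasWalkSum.nonBacktracking_add_eq (hJ : J.PosDef) (hdiag : ∀ i, J i i = 1)
    (hG : ∀ i j, i ≠ j → (J i j ≠ 0 ↔ G.Adj i j)) {i : Rest F} {s b : ℝ}
    (h : HasWalkSum (1 - J) (nonBacktrackingWalks G F i) s)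
    (hb : HasWalkSum (1 - J) (backtrackingWalks G F i) b) :
    s + b = (restJ J F)⁻¹ i i := by
  have h1 := Filter.Tendsto.add h hb
  simp only [sum_indicator_nonBacktracking hdiag hG] at h1
  have hu : IsUnit (1 - (1 - restJ J F)).det := by
    rw [sub_sub_cancel]
    exact isUnit_det_of_posDef (restJ_posDef hJ F)
  have h2 := eq_of_tendsto_sum_pow hu (Matrix.entryLinearMap ℝ ℝ i i) (s := s + b) h1
  rw [h2, sub_sub_cancel]
  rfl

theorem tendsto_sum_pow_apply (hJ : J.PosDef) (h : (1 + (1 - J)).PosDef) (i : V) :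
    Filter.Tendsto (fun N : ℕ => ∑ n ∈ Finset.range N, ((1 - J) ^ n) i i) Filter.atTop
      (𝓝 (J⁻¹ i i)) := by
  have h1 : (1 - (1 - J)).PosDef := by rwa [sub_sub_cancel]
  have h2 := tendsto_sum_pow (isUnit_det_of_posDef h1) (tendsto_pow_zero h1 h)
  rw [sub_sub_cancel] at h2
  have h3 := ((tendsto_pi_nhds.1 h2) i)
  have h4 := (tendsto_pi_nhds.1 h3) i
  simpa only [Matrix.sum_apply] using h4

/-- Positive definiteness of `2 - J` passes to principal submatrices, so no separate spectral bound
on the remaining graph is needed. -/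
theorem posDef_rest_of_spectralRadius_lt (hJ : J.PosDef) (h : spectralRadius ℝ (1 - J) < 1) :
    (1 + (1 - J)).PosDef ∧ (1 + (1 - restJ J F)).PosDef := by
  have h1 := posDef_one_add_of_spectralRadius_lt (Matrix.isHermitian_one.sub hJ.1) h
  refine ⟨h1, ?_⟩
  have h2 := restJ_posDef h1 F
  convert h2 using 1
  ext i j
  simp [Matrix.one_apply, Subtype.ext_iff]

theorem hasWalkSum_visiting (hJ : J.PosDef) (hdiag : ∀ i, J i i = 1)
    (hG : ∀ i j, i ≠ j → (J i j ≠ 0 ↔ G.Adj i j)) (h : spectralRadius ℝ (1 - J) < 1) (i : Rest F) :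
    HasWalkSum (1 - J) (visitingWalks G F i) (J⁻¹ i i - (restJ J F)⁻¹ i i) := by
  obtain ⟨h1, h2⟩ := posDef_rest_of_spectralRadius_lt (F := F) hJ h
  simp only [HasWalkSum, sum_indicator_visiting hdiag hG, Finset.sum_sub_distrib]
  exact (tendsto_sum_pow_apply hJ h1 i).sub (tendsto_sum_pow_apply (restJ_posDef hJ F) h2 i)

theorem hasWalkSum_nonBacktracking (hJ : J.PosDef) (hdiag : ∀ i, J i i = 1)
    (hG : ∀ i j, i ≠ j → (J i j ≠ 0 ↔ G.Adj i j)) (h : spectralRadius ℝ (1 - J) < 1) {i : Rest F}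
    {b : ℝ} (hb : HasWalkSum (1 - J) (backtrackingWalks G F i) b) :
    HasWalkSum (1 - J) (nonBacktrackingWalks G F i) ((restJ J F)⁻¹ i i - b) := by
  obtain ⟨-, h2⟩ := posDef_rest_of_spectralRadius_lt (F := F) hJ h
  have h3 := (tendsto_sum_pow_apply (restJ_posDef hJ F) h2 i).sub hb
  simp only [← sum_indicator_nonBacktracking hdiag hG, add_sub_cancel_right] at h3
  exact h3

end WalkSums

end GaussFMP

end

/-! ### The main theorem -/

open GaussFMP in
theorem theorem2 {V : Type*} [Fintype V] [DecidableEq V]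
    (G : SimpleGraph V) [DecidableRel G.Adj]
    (J : Matrix V V ℝ) (h : V → ℝ)
    (hJ : J.PosDef) (hdiag : ∀ i, J i i = 1)
    (hG : ∀ i j, i ≠ j → (J i j ≠ 0 ↔ G.Adj i j))
    (F : Finset V) (ini : FMPInit F)
    (hconv : FMPConverges G J h F ini) :
    -- exact means at all nodes, exact variances on `F`
    (∀ i, fmpMean G J h F ini i = (J⁻¹ *ᵥ h) i) ∧
    (∀ i ∈ F, fmpVar G J h F ini i = J⁻¹ i i) ∧
    -- walk-sum interpretation of the variances on the remaining nodes
    ((∀ i j, (restGraph G F).Adj i j → 0 ≤ ini.base.J i j) →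
      (LBPProper (restGraph G F) (restJ J F) (restPotential h F) ini.base ∨
        WalkSummable (restGraph G F) (1 - restJ J F)) →
      ∀ (i : V) (hi : i ∉ F), ∃ b : ℝ,
        HasSum (fun w : backtrackingWalks G F i => walkWeight (1 - J) (w : G.Walk i i)) b ∧
        fmpVar G J h F ini i = b + (J⁻¹ i i - (restJ J F)⁻¹ ⟨i, hi⟩ ⟨i, hi⟩) ∧
        -- the walk-sums have the right values whenever they converge
        (∀ s, HasWalkSum (1 - J) (visitingWalks G F i) s →
          fmpVar G J h F ini i = b + s) ∧
        (∀ s, HasWalkSum (1 - J) (nonBacktrackingWalks G F i) s →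
          J⁻¹ i i = fmpVar G J h F ini i + s) ∧
        -- they converge, ordered by length, if the spectral radius is less than one
        (spectralRadius ℝ (1 - J) < 1 →
          HasWalkSum (1 - J) (visitingWalks G F i) (fmpVar G J h F ini i - b) ∧
          HasWalkSum (1 - J) (nonBacktrackingWalks G F i)
            (J⁻¹ i i - fmpVar G J h F ini i)) ∧
        -- they converge absolutely if the model is walk-summable
        (WalkSummable G (1 - J) →
          HasSum (fun w : visitingWalks G F i => walkWeight (1 - J) (w : G.Walk i i))
            (fmpVar G J h F ini i - b) ∧
          HasSum (fun w : nonBacktrackingWalks G F i => walkWeight (1 - J) (w : G.Walk i i))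
            (J⁻¹ i i - fmpVar G J h F ini i))) := by
  refine ⟨fmpMean_eq hJ hG hconv, fun i hi => fmpVar_eq_of_mem hJ hG hconv hi,
    fun h₀ hp i hi => ?_⟩
  have hsymm : (1 - restJ J F).IsSymm := by
    have := Matrix.isHermitian_one.sub (restJ_posDef hJ F).1
    simpa only [Matrix.IsHermitian, Matrix.IsSymm, Matrix.conjTranspose_eq_transpose_of_trivial]
      using this
  -- Off the diagonal `1 - J` is `-J`, and the two signs cancel.
  have hRJ : ∀ i k, (restGraph G F).Adj i k → restJ J F i k * restJ J F k i =
      (1 - restJ J F) i k * (1 - restJ J F) k i := fun i k hik => by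
    simp [hik.ne, hik.ne']
  have hb := hasSum_backtrackingWalks (J := J)
    (hconv.1.hasSum_lbpVar hsymm hRJ (fun j => hdiag j) h₀ hp ⟨i, hi⟩)
  set b := lbpVar (restGraph G F) (restJ J F) (restPotential h F) ini.base ⟨i, hi⟩ with hb_def
  have hvar : fmpVar G J h F ini i = b + (J⁻¹ i i - (restJ J F)⁻¹ ⟨i, hi⟩ ⟨i, hi⟩) :=
    fmpVar_eq_of_notMem hJ hG hconv hi
  have hbw : HasWalkSum (1 - J) (backtrackingWalks G F i) b := hasWalkSum_of_hasSum hb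
  have hs : ∀ s, HasWalkSum (1 - J) (visitingWalks G F i) s →
      fmpVar G J h F ini i = b + s := fun s hs => by
    rw [hvar, HasWalkSum.visiting_eq hJ hdiag hG (i := ⟨i, hi⟩) hs]
  have hm : ∀ s, HasWalkSum (1 - J) (nonBacktrackingWalks G F i) s →
      J⁻¹ i i = fmpVar G J h F ini i + s := fun s hs => by
    have := HasWalkSum.nonBacktracking_add_eq hJ hdiag hG (i := ⟨i, hi⟩) hs hbw
    linarith
  refine ⟨b, hb, hvar, hs, hm, fun hρ => ⟨?_, ?_⟩, fun hws => ⟨?_, ?_⟩⟩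
  · rw [hvar, add_sub_cancel_left]
    exact hasWalkSum_visiting hJ hdiag hG hρ ⟨i, hi⟩
  · rw [hvar, show J⁻¹ i i - (b + (J⁻¹ i i - (restJ J F)⁻¹ ⟨i, hi⟩ ⟨i, hi⟩)) =
      (restJ J F)⁻¹ ⟨i, hi⟩ ⟨i, hi⟩ - b by ring]
    exact hasWalkSum_nonBacktracking hJ hdiag hG hρ (i := ⟨i, hi⟩) hbw
  -- Summability yields some unconditional sum; it is also the sum ordered by length, whose value is
  -- already forced by `hs`.
  · have h1 := ((hws i i).subtype (visitingWalks G F i)).hasSum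
    have h2 := hs _ (hasWalkSum_of_hasSum h1)
    rw [h2, add_sub_cancel_left]
    exact h1
  · have h1 := ((hws i i).subtype (nonBacktrackingWalks G F i)).hasSum
    have h2 := hm _ (hasWalkSum_of_hasSum h1)
    rw [h2, add_sub_cancel_left]
    exact h1
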